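/- Let $\mathcal P=[X:\mathcal R]$ be a presentation of an inverse monoid $M$, where $\mathcal R\subseteq A^*\times A^*$ is a set of pairs of words over $A=X\sqcup X^{-1}$. Let $\rho:A^*\to \mathrm{FIM}(X)$ be the natural map onto the free inverse monoid and $\theta:\mathrm{FIM}(X)\to M$ the presentation map, so that $\theta$ is onto and its kernel is the congruence generated by the pairs $(l\rho,r\rho)$, $(l,r)\in\mathcal R$. Maps are written on the right. Let $\mathcal T=\mathrm{FIM}(X)/\theta_{\min}$, where $a\,\theta_{\min}\,b$ if and only if $ae=be$ for some idempotent $e$ with $(a^{-1}a)\theta=e\theta=(b^{-1}b)\theta$, and let $\tau:\mathrm{FIM}(X)\to\mathcal T$ and $\psi:\mathcal T\to M$ be the canonical maps, so $\theta=\tau\psi$. Let $E$ be the set of idempotents of $\mathcal T$; $\mathcal T$ is regarded as a groupoid with object set $E$, in which $t$ is an arrow from $tt^{-1}$ to $t^{-1}t$ and composition is the product of $\mathcal T$. A crossed module over a groupoid $G$ with object set $V$ consists of groups $C_e$ $(e\in V)$, homomorphisms $\partial:C_e\to G(e)$ into the vertex groups of $G$, and an action of $G$ by group homomorphisms $C_e\to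 C_f$, $c\mapsto c^g$ (for $g$ an arrow from $e$ to $f$), such that $(c^g)\partial=g^{-1}(c\partial)g$ and $c^{a\partial}=a^{-1}ca$ for $a,c\in C_e$. Morphisms are families of group homomorphisms commuting with $\partial$ and with the action. Given a set $R$ and a map $\omega$ from $R$ to the loops of $G$, a crossed $G$-module $(C,\partial)$ with a map $\nu:R\to C$ such that $\nu\partial=\omega$ is free on $\omega$ if for each crossed $G$-module $(C',\partial')$ and each $\sigma:R\to C'$ with $\sigma\partial'=\omega$ there is a unique morphism $\phi:C\to C'$ with $\nu\phi=\sigma$. The Squier complex $\mathrm{Sq}(\mathcal P)$ is the $2$-complex with vertex set $\mathcal T$, with an edge $(p,l,r,q)$ from $p(l\rho\tau)q$ to $p(r\rho\tau)q$ for all $p,q\in\mathcal T$, $(l,r)\in\mathcal R$, and with a $2$-cell making the edge paths $(p,l,r,qp'(l'\rho\tau)q')\circ(p(r\rho\tau)qp',l',r',q')$ and $(p(l\rho\tau)qp',l',r',q')\circ(p,l,r,qp'(r'\rho\tau)q')$ homotopic, for all $p,q,p',q'\in\mathcal T$ and $(l,r),(l',r')\in\mathcal R$. Let $\pi$ be its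 fundamental groupoid on the vertex set $\mathcal T$; write $\alpha\mathbf d$ and $\alpha\mathbf r$ for the initial and terminal vertex of $\alpha\in\pi$. The monoid $\mathcal T$ acts on $\pi$ on both sides through $t\rhd(p,l,r,q)=(tp,l,r,q)$ and $(p,l,r,q)\lhd t=(p,l,r,qt)$, and $\alpha\ast\beta=(\alpha\lhd\beta\mathbf d)\circ(\alpha\mathbf r\rhd\beta)$. For $e\in E$ the set $\mathrm{star}_e^{\bowtie}=\{e\rhd\alpha\lhd e:\alpha\in\pi,\ \alpha\mathbf d=e\}$ is a group under $\ast$, and $S^{\bowtie}=\bigsqcup_{e\in E}\mathrm{star}_e^{\bowtie}$, with boundary map $\mathbf r$ and action $\alpha^w=w^{-1}\rhd\alpha\lhd w$, is a crossed $\mathcal T$-module. Let $R$ be the set of triples $(l,r,x)$ with $(l,r)\in\mathcal R$, $x\in E$ and $(l^{-1}r)\rho\tau\psi\geqslant x\psi$ in the natural partial order of $M$, and let $\omega$ send $(l,r,x)$ to the loop $x\,((l^{-1}r)\rho\tau)\,x$ of $\mathcal T$ at $x$. Let $C\xrightarrow{\partial}\mathcal T\rightrightarrows E$ be constructed as follows: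 $F_e$ is the free group on the pairs $((l,r,x),g)$ with $(l,r,x)\in R$ and $g$ an arrow of $\mathcal T$ from $x$ to $e$; $\mathcal T$ acts by $(s,g)^h=(s,gh)$; $\delta:(s,g)\mapsto g^{-1}(s\omega)g$; and $C_e$ is the quotient of $F_e$ by the subgroup generated by all $u^{-1}v^{-1}u\,v^{u\delta}$ $(u,v\in F_e)$, which is normal, with the induced boundary map $\partial$ and action. Then $C$, with the map $(l,r,x)\mapsto((l,r,x),x)$, is the free crossed $\mathcal T$-module on $\omega$, and there is an isomorphism of crossed $\mathcal T$-modules from $C\xrightarrow{\partial}\mathcal T\rightrightarrows E$ to $S^{\bowtie}\xrightarrow{\mathbf r}\mathcal T\rightrightarrows E$ that sends the basis element given by $(l,r,x)$ to the homotopy class of the edge $(xh^{-1},l,r,x)$, where $h=l\rho\tau$. -/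

import Mathlib

open CategoryTheory

universe u v w

/-! ### Inverse monoids -/

/-- An inverse monoid: every `a` has a unique `b` with `a b a = a` and `b a b = b`, written `a⁻¹`. -/
class InverseMonoid (S : Type u) extends Monoid S, Inv S where
  mul_inv_mul : ∀ a : S, a * a⁻¹ * a = a
  inv_mul_inv : ∀ a : S, a⁻¹ * a * a⁻¹ = a⁻¹
  inv_unique : ∀ a b : S, a * b * a = a → b * a * b = b → b = a⁻¹

namespace InverseMonoid

/-- The equational form of the axioms. -/
@[reducible] def ofEquations {S : Type u} [Monoid S] (i : S → S) (i_i : ∀ a, i (i a) = a)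
    (i_mul : ∀ a b, i (a * b) = i b * i a) (reg : ∀ a, a * i a * a = a)
    (comm : ∀ a b, (a * i a) * (b * i b) = (b * i b) * (a * i a)) : InverseMonoid S where
  inv := i
  mul_inv_mul := reg
  inv_mul_inv a := by
    have h := reg (i a)
    rwa [i_i] at h
  inv_unique a b h₁ h₂ := by
    have reg' : ∀ a, i a * a * i a = i a := fun a => by
      have h := reg (i a)
      rwa [i_i] at h
    have self : ∀ e : S, e * e = e → i e = e := fun e he => by
      have c := comm (i e) e
      rw [i_i] at c
      have hie : i e * i e = i e := by rw [← i_mul, he]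
      calc i e = i e * (e * e) * i e := by rw [he, reg']
        _ = (i e * e) * (e * i e) := by simp only [mul_assoc]
        _ = (e * i e) * (i e * e) := c
        _ = e * (i e * i e) * e := by simp only [mul_assoc]
        _ = e := by rw [hie, reg]
    have idc : ∀ e f : S, e * e = e → f * f = f → e * f = f * e := fun e f he hf => by
      have h := comm e f
      rwa [self e he, self f hf, he, hf] at h
    have k₁ : (a * b) * (a * i a) = (a * i a) * (a * b) :=
      idc _ _ (by rw [← mul_assoc, h₁]) (by rw [← mul_assoc, reg])
    have k₂ : (b * a) * (i a * a) = (i a * a) * (b * a) :=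
      idc _ _ (by rw [← mul_assoc, h₂]) (by rw [← mul_assoc, reg'])
    have e₁ : b = i a * a * b := by
      calc b = b * a * b := h₂.symm
        _ = b * (a * i a * a) * b := by rw [reg]
        _ = (b * a) * (i a * a) * b := by simp only [mul_assoc]
        _ = i a * a * (b * a * b) := by rw [k₂]; simp only [mul_assoc]
        _ = i a * a * b := by rw [h₂]
    have e₂ : i a = i a * a * b := by
      calc i a = i a * a * i a := (reg' a).symm
        _ = i a * (a * b * a) * i a := by rw [h₁]
        _ = i a * ((a * b) * (a * i a)) := by simp only [mul_assoc]
        _ = (i a * a * i a) * a * b := by rw [k₁]; simp only [mul_assoc]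
        _ = i a * a * b := by rw [reg']
    exact e₁.trans e₂.symm

variable {S : Type u} [InverseMonoid S]

theorem inv_inv' (a : S) : a⁻¹⁻¹ = a :=
  (inv_unique a⁻¹ a (inv_mul_inv a) (mul_inv_mul a)).symm

theorem idem_inv {e : S} (he : e * e = e) : e⁻¹ = e :=
  (inv_unique e e (by rw [he, he]) (by rw [he, he])).symm

theorem idem_mul_inv (a : S) : (a * a⁻¹) * (a * a⁻¹) = a * a⁻¹ := by
  rw [← mul_assoc, mul_inv_mul]

theorem idem_inv_mul (a : S) : (a⁻¹ * a) * (a⁻¹ * a) = a⁻¹ * a := by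
  rw [← mul_assoc, inv_mul_inv]

theorem idem_mul {e f : S} (he : e * e = e) (hf : f * f = f) : (e * f) * (e * f) = e * f := by
  have hx : e * f = (f * (e * f)⁻¹ * e)⁻¹ := by
    apply inv_unique
    · calc f * (e * f)⁻¹ * e * (e * f) * (f * (e * f)⁻¹ * e)
          = f * (e * f)⁻¹ * (e * e) * (f * f) * (e * f)⁻¹ * e := by simp only [mul_assoc]
        _ = f * ((e * f)⁻¹ * (e * f) * (e * f)⁻¹) * e := by rw [he, hf]; simp only [mul_assoc]
        _ = _ := by rw [inv_mul_inv]
    · calc e * f * (f * (e * f)⁻¹ * e) * (e * f)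
          = e * (f * f) * (e * f)⁻¹ * (e * e) * f := by simp only [mul_assoc]
        _ = (e * f) * (e * f)⁻¹ * (e * f) := by rw [he, hf]; simp only [mul_assoc]
        _ = _ := mul_inv_mul _
  have hi : (f * (e * f)⁻¹ * e) * (f * (e * f)⁻¹ * e) = f * (e * f)⁻¹ * e := by
    calc (f * (e * f)⁻¹ * e) * (f * (e * f)⁻¹ * e)
          = f * ((e * f)⁻¹ * (e * f) * (e * f)⁻¹) * e := by simp only [mul_assoc]
      _ = _ := by rw [inv_mul_inv]
  rw [idem_inv hi] at hx
  rw [hx, hi]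

theorem idem_comm {e f : S} (he : e * e = e) (hf : f * f = f) : e * f = f * e := by
  have h₁ := idem_mul he hf
  have h₂ := idem_mul hf he
  have : f * e = (e * f)⁻¹ := by
    apply inv_unique
    · calc e * f * (f * e) * (e * f) = e * (f * f) * (e * e) * f := by simp only [mul_assoc]
        _ = (e * f) * (e * f) := by rw [he, hf]; simp only [mul_assoc]
        _ = _ := h₁
    · calc f * e * (e * f) * (f * e) = f * (e * e) * (f * f) * e := by simp only [mul_assoc]
        _ = (f * e) * (f * e) := by rw [he, hf]; simp only [mul_assoc]
        _ = _ := h₂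
  rw [this, idem_inv h₁]

theorem mul_inv' (a b : S) : (a * b)⁻¹ = b⁻¹ * a⁻¹ := by
  symm
  have c := idem_comm (idem_mul_inv b) (idem_inv_mul a)
  apply inv_unique
  · calc a * b * (b⁻¹ * a⁻¹) * (a * b) = a * ((b * b⁻¹) * (a⁻¹ * a)) * b := by
          simp only [mul_assoc]
      _ = (a * a⁻¹ * a) * (b * b⁻¹ * b) := by rw [c]; simp only [mul_assoc]
      _ = _ := by rw [mul_inv_mul, mul_inv_mul]
  · calc b⁻¹ * a⁻¹ * (a * b) * (b⁻¹ * a⁻¹) = b⁻¹ * ((a⁻¹ * a) * (b * b⁻¹)) * a⁻¹ := by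
          simp only [mul_assoc]
      _ = (b⁻¹ * b * b⁻¹) * (a⁻¹ * a * a⁻¹) := by rw [← c]; simp only [mul_assoc]
      _ = _ := by rw [inv_mul_inv, inv_mul_inv]

theorem map_inv' {N : Type v} [InverseMonoid N] (φ : S →* N) (a : S) : φ a⁻¹ = (φ a)⁻¹ :=
  inv_unique _ _ (by rw [← map_mul, ← map_mul, mul_inv_mul])
    (by rw [← map_mul, ← map_mul, inv_mul_inv])

theorem idem_conj (a : S) {e : S} (he : e * e = e) :
    (a⁻¹ * e * a) * (a⁻¹ * e * a) = a⁻¹ * e * a := by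
  calc (a⁻¹ * e * a) * (a⁻¹ * e * a) = a⁻¹ * (e * (a * a⁻¹)) * e * a := by simp only [mul_assoc]
    _ = (a⁻¹ * a * a⁻¹) * (e * e) * a := by
        rw [idem_comm he (idem_mul_inv a)]; simp only [mul_assoc]
    _ = _ := by rw [inv_mul_inv, he]

theorem con_inv (c : Con S) {a b : S} (h : c a b) : c a⁻¹ b⁻¹ := by
  rw [← c.eq] at h ⊢
  have x₁ : (↑a⁻¹ : c.Quotient) * ↑a * ↑a⁻¹ = ↑a⁻¹ := by
    rw [← c.coe_mul, ← c.coe_mul, inv_mul_inv]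
  have x₂ : (↑a : c.Quotient) * ↑a⁻¹ * ↑a = ↑a := by
    rw [← c.coe_mul, ← c.coe_mul, mul_inv_mul]
  have y₁ : (↑b⁻¹ : c.Quotient) * ↑a * ↑b⁻¹ = ↑b⁻¹ := by
    rw [h, ← c.coe_mul, ← c.coe_mul, inv_mul_inv]
  have y₂ : (↑a : c.Quotient) * ↑b⁻¹ * ↑a = ↑a := by
    rw [h, ← c.coe_mul, ← c.coe_mul, mul_inv_mul]
  have c₁ : ((↑a⁻¹ : c.Quotient) * ↑a) * (↑b⁻¹ * ↑a) = (↑b⁻¹ * ↑a) * (↑a⁻¹ * ↑a) := by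
    have := congrArg (fun s : S => (s : c.Quotient)) (idem_comm (idem_inv_mul a) (idem_inv_mul b))
    simp only [c.coe_mul] at this
    rwa [← h] at this
  have c₂ : ((↑a : c.Quotient) * ↑a⁻¹) * (↑a * ↑b⁻¹) = (↑a * ↑b⁻¹) * (↑a * ↑a⁻¹) := by
    have := congrArg (fun s : S => (s : c.Quotient)) (idem_comm (idem_mul_inv a) (idem_mul_inv b))
    simp only [c.coe_mul] at this
    rwa [← h] at this
  generalize (↑a⁻¹ : c.Quotient) = x at *
  generalize (↑b⁻¹ : c.Quotient) = y at *
  generalize (↑a : c.Quotient) = z at *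
  calc x = x * (z * y * z) * x := by rw [y₂, x₁]
    _ = (x * z) * (y * z) * x := by simp only [mul_assoc]
    _ = y * z * (x * z * x) := by rw [c₁]; simp only [mul_assoc]
    _ = y * (z * y * z) * x := by rw [x₁, y₂]
    _ = y * ((z * y) * (z * x)) := by simp only [mul_assoc]
    _ = y * (z * x * z) * y := by rw [← c₂]; simp only [mul_assoc]
    _ = y := by rw [x₂, y₁]

/-- A quotient of an inverse monoid by a monoid congruence is an inverse monoid. -/
instance conQuotient (c : Con S) : InverseMonoid c.Quotient :=
  ofEquations (Quotient.map' (fun a : S => a⁻¹) fun _ _ h => con_inv c h)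
    (by rintro ⟨a⟩; exact congrArg (fun s : S => (s : c.Quotient)) (inv_inv' a))
    (by rintro ⟨a⟩ ⟨b⟩; exact congrArg (fun s : S => (s : c.Quotient)) (mul_inv' a b))
    (by rintro ⟨a⟩; exact congrArg (fun s : S => (s : c.Quotient)) (mul_inv_mul a))
    (by
      rintro ⟨a⟩ ⟨b⟩
      exact congrArg (fun s : S => (s : c.Quotient))
        (idem_comm (idem_mul_inv a) (idem_mul_inv b)))

/-- The natural partial order: `NatLE a b` means `a ≤ b`. -/
def NatLE (a b : S) : Prop := ∃ e : S, e * e = e ∧ a = b * e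

/-- For a homomorphism `θ` with kernel congruence `κ`, the smallest congruence with the same
trace as `κ`: `a ∼ b` iff there is an idempotent `e` with `a e = b e` and
`a⁻¹ a κ e κ b⁻¹ b`. -/
def minCon {N : Type v} [InverseMonoid N] (θ : S →* N) : Con S where
  r a b := ∃ e : S, e * e = e ∧ a * e = b * e ∧ θ (a⁻¹ * a) = θ e ∧ θ e = θ (b⁻¹ * b)
  iseqv :=
    { refl := fun a => ⟨a⁻¹ * a, idem_inv_mul a, rfl, rfl, rfl⟩
      symm := fun ⟨e, he, h, h₁, h₂⟩ => ⟨e, he, h.symm, h₂.symm, h₁.symm⟩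
      trans := by
        rintro a b c ⟨e, he, h, h₁, h₂⟩ ⟨f, hf, k, k₁, k₂⟩
        have hef : θ e = θ f := h₂.trans k₁
        have hθ : θ (e * f) = θ e := by rw [map_mul, ← hef, ← map_mul, he]
        refine ⟨e * f, idem_mul he hf, ?_, h₁.trans hθ.symm, hθ.trans (hef.trans k₂)⟩
        rw [← mul_assoc, h, mul_assoc, idem_comm he hf, ← mul_assoc, k, mul_assoc] }
  mul' := by
    rintro a b c d ⟨e, he, h, h₁, h₂⟩ ⟨f, hf, k, k₁, k₂⟩
    have hfi := idem_inv hf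
    have hei := idem_inv he
    have key : ∀ x y : S, x * y * ((y * f)⁻¹ * e * (y * f)) = x * e * (y * f) := by
      intro x y
      have hy : y * (y * f)⁻¹ = (y * f) * (y * f)⁻¹ := by
        rw [mul_inv', hfi, ← mul_assoc, ← mul_assoc, mul_assoc y f f, hf]
      calc x * y * ((y * f)⁻¹ * e * (y * f)) = x * (y * (y * f)⁻¹) * e * (y * f) := by
            simp only [mul_assoc]
        _ = x * ((y * f * (y * f)⁻¹) * e) * (y * f) := by rw [hy]; simp only [mul_assoc]
        _ = x * e * (y * f * (y * f)⁻¹ * (y * f)) := by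
            rw [idem_comm (idem_mul_inv _) he]; simp only [mul_assoc]
        _ = _ := by rw [mul_inv_mul]
    have hc : ∀ y : S, θ f = θ (y⁻¹ * y) → θ (y * f) = θ y := fun y hy => by
      rw [map_mul, hy, ← map_mul, ← mul_assoc, mul_inv_mul]
    have hθ : ∀ x y : S, θ e = θ (x⁻¹ * x) → θ f = θ (y⁻¹ * y) →
        θ ((y * f)⁻¹ * e * (y * f)) = θ ((x * y)⁻¹ * (x * y)) := fun x y hx hy => by
      rw [map_mul, map_mul, map_inv', hc y hy, hx, mul_inv', ← map_inv', ← map_mul, ← map_mul]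
      simp only [mul_assoc]
    refine ⟨(c * f)⁻¹ * e * (c * f), idem_conj _ he, ?_, (hθ a c h₁.symm k₁.symm).symm, ?_⟩
    · rw [key, k, key, h]
    · rw [k]; exact hθ b d h₂ k₂

/-- An idempotent of an inverse monoid. -/
@[ext] structure Idem (S : Type u) [InverseMonoid S] : Type u where
  val : S
  idem : val * val = val

/-- An element `t` with `t t⁻¹ = e` and `t⁻¹ t = f`. -/
@[ext] structure Arrow {S : Type u} [InverseMonoid S] (e f : Idem S) : Type u where
  val : S
  dom : val * val⁻¹ = e.val
  cod : val⁻¹ * val = f.val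

theorem Arrow.dom_mul {e f : Idem S} (s : Arrow e f) : e.val * s.val = s.val := by
  rw [← s.dom, mul_inv_mul]

theorem Arrow.mul_cod {e f : Idem S} (s : Arrow e f) : s.val * f.val = s.val := by
  rw [← s.cod, ← mul_assoc, mul_inv_mul]

/-- An inverse monoid as a groupoid under the restricted product: objects are the idempotents, an
element `t` is an arrow from `t t⁻¹` to `t⁻¹ t`, and composition is multiplication. -/
instance traceGroupoid (S : Type u) [InverseMonoid S] : Groupoid (Idem S) where
  Hom e f := Arrow e f
  id e := ⟨e.val, by rw [idem_inv e.idem, e.idem], by rw [idem_inv e.idem, e.idem]⟩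
  comp s t := ⟨s.val * t.val, by
      rw [mul_inv', mul_assoc, ← mul_assoc t.val, t.dom, ← mul_assoc, s.mul_cod, s.dom], by
      rw [mul_inv', mul_assoc, ← mul_assoc _ s.val, s.cod, t.dom_mul, t.cod]⟩
  id_comp s := Arrow.ext s.dom_mul
  comp_id s := Arrow.ext s.mul_cod
  assoc s t r := Arrow.ext (mul_assoc s.val t.val r.val)
  inv s := ⟨s.val⁻¹, by rw [inv_inv', s.cod], by rw [inv_inv', s.dom]⟩
  inv_comp s := Arrow.ext s.cod
  comp_inv s := Arrow.ext s.dom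

end InverseMonoid

/-! ### Crossed modules of groupoids -/

/-- A crossed module over a groupoid with object set `V`. Composition in the groupoid and the
product of the vertex groups `e ⟶ e` are written in the same order: `g h` is `g ≫ h`. -/
structure CrossedModule (V : Type u) [Groupoid.{v} V] where
  C : V → Type w
  [group : ∀ e, Group (C e)]
  bd : ∀ e, C e →* (e ⟶ e)
  act : ∀ {e f : V}, (e ⟶ f) → (C e →* C f)
  act_id : ∀ (e : V) (c : C e), act (𝟙 e) c = c
  act_comp : ∀ {e f k : V} (g : e ⟶ f) (h : f ⟶ k) (c : C e), act (g ≫ h) c = act h (act g c)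
  bd_act : ∀ {e f : V} (g : e ⟶ f) (c : C e), bd f (act g c) = Groupoid.inv g ≫ bd e c ≫ g
  act_bd : ∀ {e : V} (a c : C e), act (bd e a) c = a⁻¹ * c * a

namespace CrossedModule

attribute [instance] CrossedModule.group

universe w₁ w₂

variable {V : Type u} [Groupoid.{v} V]

/-- A morphism of crossed modules over a fixed groupoid. -/
@[ext] structure Hom (A : CrossedModule.{u, v, w₁} V) (B : CrossedModule.{u, v, w₂} V) where
  map : ∀ e, A.C e →* B.C e
  bd_map : ∀ (e : V) (c : A.C e), B.bd e (map e c) = A.bd e c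
  act_map : ∀ {e f : V} (g : e ⟶ f) (c : A.C e), map f (A.act g c) = B.act g (map e c)

/-- An isomorphism of crossed modules over a fixed groupoid. -/
structure Iso (A : CrossedModule.{u, v, w₁} V) (B : CrossedModule.{u, v, w₂} V) where
  map : ∀ e, A.C e ≃* B.C e
  bd_map : ∀ (e : V) (c : A.C e), B.bd e (map e c) = A.bd e c
  act_map : ∀ {e f : V} (g : e ⟶ f) (c : A.C e), map f (A.act g c) = B.act g (map e c)

/-- `A`, together with `ν`, is the free crossed module on `ω`, where `ω` assigns to each `r : R` a
loop of the groupoid at the object `b r`. -/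
def IsFreeOn {R : Type w} (A : CrossedModule.{u, v, w₁} V) (b : R → V) (ω : ∀ r, b r ⟶ b r)
    (ν : ∀ r, A.C (b r)) : Prop :=
  (∀ r, A.bd (b r) (ν r) = ω r) ∧
  ∀ (B : CrossedModule.{u, v, w₂} V) (σ : ∀ r, B.C (b r)), (∀ r, B.bd (b r) (σ r) = ω r) →
    ∃! φ : Hom A B, ∀ r, φ.map (b r) (ν r) = σ r

section Free

variable {R : Type w} (b : R → V) (ω : ∀ r, b r ⟶ b r)

/-- The generators at `e`: pairs `(r, g)` with `g` an arrow from the base point of `r` to `e`. -/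
structure FreeGen (e : V) : Type (max v w) where
  fst : R
  snd : b fst ⟶ e

/-- The boundary of the free pre-crossed module, `(r, g) ↦ g⁻¹ (ω r) g`. -/
def freeBd (e : V) : FreeGroup (FreeGen b e) →* (e ⟶ e) :=
  FreeGroup.lift fun s => Groupoid.inv s.snd ≫ ω s.fst ≫ s.snd

/-- The action on the free pre-crossed module, `(r, g)^h = (r, g h)`. -/
def freeAct {e f : V} (h : e ⟶ f) : FreeGroup (FreeGen b e) →* FreeGroup (FreeGen b f) :=
  FreeGroup.map fun s => ⟨s.fst, s.snd ≫ h⟩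

/-- The Peiffer subgroup at `e`, generated by the elements `u⁻¹ v⁻¹ u v^{δ u}`. -/
def peiffer (e : V) : Subgroup (FreeGroup (FreeGen b e)) :=
  Subgroup.closure {x | ∃ u v, x = u⁻¹ * v⁻¹ * u * freeAct b (freeBd b ω e u) v}

theorem freeAct_of {e f : V} (h : e ⟶ f) (s : FreeGen b e) :
    freeAct b h (FreeGroup.of s) = FreeGroup.of ⟨s.fst, s.snd ≫ h⟩ := FreeGroup.map.of

theorem freeBd_of (e : V) (s : FreeGen b e) :
    freeBd b ω e (FreeGroup.of s) = Groupoid.inv s.snd ≫ ω s.fst ≫ s.snd := FreeGroup.lift_apply_of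

theorem freeAct_id (e : V) (x : FreeGroup (FreeGen b e)) : freeAct b (𝟙 e) x = x := by
  have : freeAct b (𝟙 e) = MonoidHom.id _ := by
    apply FreeGroup.ext_hom
    intro s
    rw [freeAct_of, Category.comp_id]
    rfl
  rw [this]
  rfl

theorem freeAct_comp {e f k : V} (g : e ⟶ f) (h : f ⟶ k) (x : FreeGroup (FreeGen b e)) :
    freeAct b (g ≫ h) x = freeAct b h (freeAct b g x) := by
  have : freeAct b (g ≫ h) = (freeAct b h).comp (freeAct b g) := by
    apply FreeGroup.ext_hom
    intro s
    rw [MonoidHom.comp_apply, freeAct_of, freeAct_of, freeAct_of, Category.assoc]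
  rw [this]
  rfl

theorem freeBd_act {e f : V} (g : e ⟶ f) (x : FreeGroup (FreeGen b e)) :
    freeBd b ω f (freeAct b g x) = Groupoid.inv g ≫ freeBd b ω e x ≫ g := by
  have : (freeBd b ω f).comp (freeAct b g) =
      (Groupoid.vertexGroupIsomOfMap g).toMonoidHom.comp (freeBd b ω e) := by
    apply FreeGroup.ext_hom
    intro s
    rw [MonoidHom.comp_apply, freeAct_of, freeBd_of, MonoidHom.comp_apply, freeBd_of]
    simp [Groupoid.inv_eq_inv]
  exact DFunLike.congr_fun this x

theorem freeAct_peiffer {e f : V} (g : e ⟶ f) (u v : FreeGroup (FreeGen b e)) :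
    freeAct b g (freeAct b (freeBd b ω e u) v) =
      freeAct b (freeBd b ω f (freeAct b g u)) (freeAct b g v) := by
  rw [freeBd_act, ← freeAct_comp, ← freeAct_comp]
  simp [Groupoid.inv_eq_inv]

instance peiffer_normal (e : V) : (peiffer b ω e).Normal := by
  refine ⟨fun n hn g => ?_⟩
  have key : peiffer b ω e ≤ (peiffer b ω e).comap (MulAut.conj g).toMonoidHom := by
    refine (Subgroup.closure_le _).2 ?_
    rintro _ ⟨u, v, rfl⟩
    have h₁ : (u * g⁻¹)⁻¹ * v⁻¹ * (u * g⁻¹) * freeAct b (freeBd b ω e (u * g⁻¹)) v ∈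
        peiffer b ω e := Subgroup.subset_closure ⟨_, _, rfl⟩
    have h₂ : (g⁻¹)⁻¹ * (freeAct b (freeBd b ω e u) v)⁻¹ * g⁻¹ *
        freeAct b (freeBd b ω e g⁻¹) (freeAct b (freeBd b ω e u) v) ∈
        peiffer b ω e := Subgroup.subset_closure ⟨_, _, rfl⟩
    have h₃ := mul_mem h₁ (inv_mem h₂)
    rw [map_mul (freeBd b ω e) u, Groupoid.vertexGroup_mul, freeAct_comp] at h₃
    change g * _ * g⁻¹ ∈ peiffer b ω e
    convert h₃ using 1
    group
  exact key hn

/-- The free crossed module on `ω`: the quotient of the free pre-crossed module by the Peiffer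
subgroups. -/
def free : CrossedModule.{u, v, max v w} V where
  C e := FreeGroup (FreeGen b e) ⧸ peiffer b ω e
  bd e := QuotientGroup.lift (peiffer b ω e) (freeBd b ω e) (by
    refine (Subgroup.closure_le (MonoidHom.ker (freeBd b ω e))).2 ?_
    rintro _ ⟨u, v, rfl⟩
    simp only [SetLike.mem_coe, MonoidHom.mem_ker, map_mul, map_inv, freeBd_act]
    rw [← Groupoid.vertexGroup_inv, ← Groupoid.vertexGroup_mul, ← Groupoid.vertexGroup_mul]
    group)
  act {e f} g := QuotientGroup.map _ _ (freeAct b g) (by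
    refine (Subgroup.closure_le _).2 ?_
    rintro _ ⟨u, v, rfl⟩
    refine Subgroup.subset_closure ⟨freeAct b g u, freeAct b g v, ?_⟩
    rw [map_mul, map_mul, map_mul, map_inv, map_inv, freeAct_peiffer])
  act_id e := by
    rintro ⟨c⟩
    exact congrArg _ (freeAct_id b e c)
  act_comp g h := by
    rintro ⟨c⟩
    exact congrArg _ (freeAct_comp b g h c)
  bd_act g := by
    rintro ⟨c⟩
    exact freeBd_act b ω g c
  act_bd {e} := by
    rintro ⟨a⟩ ⟨c⟩
    refine (QuotientGroup.eq.2 ?_ : ((a⁻¹ * c * a : FreeGroup (FreeGen b e)) :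
      FreeGroup (FreeGen b e) ⧸ peiffer b ω e) = (freeAct b (freeBd b ω e a) c :)).symm
    refine Subgroup.subset_closure ⟨a, c, ?_⟩
    group

/-- The basis of the free crossed module: `r ↦ (r, 1)`. -/
def freeBasis (r : R) : (free b ω).C (b r) :=
  QuotientGroup.mk' (peiffer b ω (b r)) (FreeGroup.of ⟨r, 𝟙 (b r)⟩)

end Free

end CrossedModule

/-! ### Inverse monoid presentations -/

section Presentation

open InverseMonoid

/-- Words in the alphabet `X ⊔ X⁻¹`; `(x, true)` stands for `x` and `(x, false)` for `x⁻¹`. -/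
abbrev Words (X : Type u) : Type u := FreeMonoid (X × Bool)

/-- The formal inverse of a word. -/
def wordInv {X : Type u} (p : Words X) : Words X :=
  FreeMonoid.ofList (FreeGroup.invRev p.toList)

theorem wordInv_wordInv {X : Type u} (p : Words X) : wordInv (wordInv p) = p :=
  FreeGroup.invRev_invRev

theorem wordInv_mul {X : Type u} (p q : Words X) : wordInv (p * q) = wordInv q * wordInv p := by
  change FreeGroup.invRev (p.toList ++ q.toList) = _
  simp [FreeGroup.invRev, wordInv]
  rfl

/-- Generators of the Wagner congruence. -/
inductive WagnerRel (X : Type u) : Words X → Words X → Prop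
  | regular (p : Words X) : WagnerRel X (p * wordInv p * p) p
  | comm (p q : Words X) :
      WagnerRel X ((p * wordInv p) * (q * wordInv q)) ((q * wordInv q) * (p * wordInv p))

/-- The Wagner congruence. -/
def wagner (X : Type u) : Con (Words X) := conGen (WagnerRel X)

/-- The free inverse monoid on `X`. -/
def FIM (X : Type u) : Type u := (wagner X).Quotient

theorem wagner_inv {X : Type u} {p q : Words X} (h : wagner X p q) :
    wagner X (wordInv p) (wordInv q) := by
  induction h with
  | of x y h =>
    cases h with
    | regular =>
      rw [wordInv_mul, wordInv_mul, wordInv_wordInv, ← mul_assoc]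
      have := WagnerRel.regular (wordInv y)
      rw [wordInv_wordInv] at this
      exact ConGen.Rel.of _ _ this
    | comm p q =>
      simp only [wordInv_mul, wordInv_wordInv]
      exact ConGen.Rel.of _ _ (WagnerRel.comm q p)
  | refl x => exact (wagner X).refl _
  | symm _ ih => exact (wagner X).symm ih
  | trans _ _ ih₁ ih₂ => exact (wagner X).trans ih₁ ih₂
  | mul _ _ ih₁ ih₂ =>
    rw [wordInv_mul, wordInv_mul]
    exact (wagner X).mul ih₂ ih₁

instance (X : Type u) : InverseMonoid (FIM X) :=
  letI : Monoid (FIM X) := inferInstanceAs (Monoid (wagner X).Quotient)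
  InverseMonoid.ofEquations (S := FIM X)
    (Quotient.map' (s₁ := (wagner X).toSetoid) (s₂ := (wagner X).toSetoid) wordInv
      fun _ _ h => wagner_inv h)
    (by rintro ⟨a⟩; exact congrArg (fun s : Words X => (s : (wagner X).Quotient)) (wordInv_wordInv a))
    (by rintro ⟨a⟩ ⟨b⟩; exact congrArg (fun s : Words X => (s : (wagner X).Quotient)) (wordInv_mul a b))
    (by rintro ⟨a⟩; exact (wagner X).eq.2 (ConGen.Rel.of _ _ (WagnerRel.regular a)))
    (by rintro ⟨a⟩ ⟨b⟩; exact (wagner X).eq.2 (ConGen.Rel.of _ _ (WagnerRel.comm a b)))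

/-- The natural map `ρ` from words to the free inverse monoid. -/
def FIM.ρ (X : Type u) : Words X →* FIM X := (wagner X).mk'

/-- A presentation `[X : rels]` of the inverse monoid `M`, with presentation map `θ`: the map `θ`
is onto, and its kernel is the congruence on the free inverse monoid generated by the relations. -/
structure InvPresentation (X : Type u) (M : Type v) [InverseMonoid M] where
  rels : Set (Words X × Words X)
  θ : FIM X →* M
  surjective : Function.Surjective θ
  ker_eq : Con.ker θ = conGen fun a b => ∃ s ∈ rels, a = FIM.ρ X s.1 ∧ b = FIM.ρ X s.2

namespace InvPresentation

variable {X : Type u} {M : Type v} [InverseMonoid M] (P : InvPresentation X M)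

/-- The inverse monoid `𝒯 = FIM(X) / θ_min`. -/
abbrev T : Type u := (minCon P.θ).Quotient

/-- The canonical map `τ : FIM(X) → 𝒯`. -/
def τ : FIM X →* P.T := (minCon P.θ).mk'

/-- The canonical map `ψ : 𝒯 → M`. -/
def ψ : P.T →* M := (minCon P.θ).lift P.θ (by
  rintro a b ⟨e, -, h, h₁, h₂⟩
  change P.θ a = P.θ b
  calc P.θ a = P.θ a * P.θ (a⁻¹ * a) := by rw [← map_mul, ← mul_assoc, mul_inv_mul]
    _ = P.θ (b * e) := by rw [h₁, ← map_mul, h]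
    _ = P.θ b := by rw [map_mul, h₂, ← map_mul, ← mul_assoc, mul_inv_mul])

/-- The composite `ρ τ` from words to `𝒯`. -/
def ρτ : Words X →* P.T := P.τ.comp (FIM.ρ X)

theorem ψ_τ (a : FIM X) : P.ψ (P.τ a) = P.θ a := rfl

theorem ρτ_wordInv (p : Words X) : P.ρτ (wordInv p) = (P.ρτ p)⁻¹ := rfl

theorem ψ_idem {e f : P.T} (he : e * e = e) (hf : f * f = f) (h : P.ψ e = P.ψ f) : e = f := by
  have lift : ∀ g : P.T, g * g = g → ∃ a : FIM X, a * a = a ∧ P.τ a = g := by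
    intro g hg
    obtain ⟨a, rfl⟩ := Con.mk'_surjective g
    refine ⟨a * a⁻¹, idem_mul_inv a, ?_⟩
    change P.τ (a * a⁻¹) = P.τ a
    have hg' : P.τ a * P.τ a = P.τ a := hg
    rw [map_mul, map_inv', idem_inv hg', hg']
  obtain ⟨a, ha, rfl⟩ := lift e he
  obtain ⟨b, hb, rfl⟩ := lift f hf
  rw [ψ_τ, ψ_τ] at h
  refine (minCon P.θ).eq.2 ⟨a * b, idem_mul ha hb, ?_, ?_, ?_⟩
  · rw [← mul_assoc, ha, ← mul_assoc, idem_comm hb ha, mul_assoc, hb]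
  · rw [idem_inv ha, ha, map_mul, ← h, ← map_mul, ha]
  · rw [idem_inv hb, hb, map_mul, h, ← map_mul, hb]

theorem ψ_rel (s : P.rels) : P.ψ (P.ρτ s.1.1) = P.ψ (P.ρτ s.1.2) := by
  have h : Con.ker P.θ (FIM.ρ X s.1.1) (FIM.ρ X s.1.2) := by
    rw [P.ker_eq]
    exact ConGen.Rel.of _ _ ⟨s.1, s.2, rfl, rfl⟩
  exact h

/-- If `a ψ` is an idempotent `e ψ` then `a a⁻¹ = e = a⁻¹ a`. -/
theorem ψ_ker {a e : P.T} (he : e * e = e) (h : P.ψ a = P.ψ e) :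
    a * a⁻¹ = e ∧ a⁻¹ * a = e := by
  constructor
  · apply P.ψ_idem (idem_mul_inv a) he
    rw [map_mul, map_inv', h, ← map_inv', ← map_mul, idem_inv he, he]
  · apply P.ψ_idem (idem_inv_mul a) he
    rw [map_mul, map_inv', h, ← map_inv', ← map_mul, idem_inv he, he]

/-! #### The Squier complex and its fundamental groupoid -/

/-- An edge `(p, l, r, q)` of the Squier complex, where `rel = (l, r)`. -/
@[ext] structure Edge where
  p : P.T
  rel : P.rels
  q : P.T

/-- An edge with an orientation; `fwd = false` is the edge traversed backwards. -/
@[ext] structure SEdge where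
  edge : P.Edge
  fwd : Bool

variable {P}

/-- The initial vertex `p (l ρ τ) q`. -/
def Edge.dom (s : P.Edge) : P.T := s.p * P.ρτ s.rel.1.1 * s.q

/-- The terminal vertex `p (r ρ τ) q`. -/
def Edge.cod (s : P.Edge) : P.T := s.p * P.ρτ s.rel.1.2 * s.q

namespace SEdge

def dom (s : P.SEdge) : P.T := bif s.fwd then s.edge.dom else s.edge.cod

def cod (s : P.SEdge) : P.T := bif s.fwd then s.edge.cod else s.edge.dom

def inv (s : P.SEdge) : P.SEdge := ⟨s.edge, !s.fwd⟩

/-- `x ▷ (p, l, r, q) = (x p, l, r, q)`. -/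
def lw (x : P.T) (s : P.SEdge) : P.SEdge := ⟨⟨x * s.edge.p, s.edge.rel, s.edge.q⟩, s.fwd⟩

/-- `(p, l, r, q) ◁ x = (p, l, r, q x)`. -/
def rw (x : P.T) (s : P.SEdge) : P.SEdge := ⟨⟨s.edge.p, s.edge.rel, s.edge.q * x⟩, s.fwd⟩

theorem dom_inv (s : P.SEdge) : s.inv.dom = s.cod := by
  obtain ⟨s, _ | _⟩ := s <;> rfl

theorem cod_inv (s : P.SEdge) : s.inv.cod = s.dom := by
  obtain ⟨s, _ | _⟩ := s <;> rfl

theorem inv_inv (s : P.SEdge) : s.inv.inv = s := by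
  obtain ⟨s, _ | _⟩ := s <;> rfl

theorem dom_lw (x : P.T) (s : P.SEdge) : (s.lw x).dom = x * s.dom := by
  obtain ⟨s, _ | _⟩ := s <;> simp [dom, lw, Edge.dom, Edge.cod, mul_assoc]

theorem cod_lw (x : P.T) (s : P.SEdge) : (s.lw x).cod = x * s.cod := by
  obtain ⟨s, _ | _⟩ := s <;> simp [cod, lw, Edge.dom, Edge.cod, mul_assoc]

theorem dom_rw (x : P.T) (s : P.SEdge) : (s.rw x).dom = s.dom * x := by
  obtain ⟨s, _ | _⟩ := s <;> simp [dom, rw, Edge.dom, Edge.cod, mul_assoc]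

theorem cod_rw (x : P.T) (s : P.SEdge) : (s.rw x).cod = s.cod * x := by
  obtain ⟨s, _ | _⟩ := s <;> simp [cod, rw, Edge.dom, Edge.cod, mul_assoc]

theorem lw_lw (x y : P.T) (s : P.SEdge) : (s.lw y).lw x = s.lw (x * y) := by
  simp [lw, mul_assoc]

theorem rw_rw (x y : P.T) (s : P.SEdge) : (s.rw x).rw y = s.rw (x * y) := by
  simp [rw, mul_assoc]

theorem lw_rw (x y : P.T) (s : P.SEdge) : (s.rw y).lw x = (s.lw x).rw y := rfl

end SEdge

/-- `IsPath a k b`: the list `k` of oriented edges is an edge path from `a` to `b`. -/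
def IsPath (a : P.T) : List P.SEdge → P.T → Prop
  | [], b => a = b
  | s :: k, b => s.dom = a ∧ IsPath s.cod k b

/-- Homotopy of edge paths from `a` to `b`: the congruence generated by cancellation of `s s⁻¹`
and by the `2`-cells. -/
inductive Hty : P.T → P.T → List P.SEdge → List P.SEdge → Prop
  | refl {a b : P.T} {k : List P.SEdge} : IsPath a k b → Hty a b k k
  | symm {a b : P.T} {k k' : List P.SEdge} : Hty a b k k' → Hty a b k' k
  | trans {a b : P.T} {k k' k'' : List P.SEdge} : Hty a b k k' → Hty a b k' k'' → Hty a b k k''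
  | append {a b c : P.T} {k k' j j' : List P.SEdge} :
      Hty a b k k' → Hty b c j j' → Hty a c (k ++ j) (k' ++ j')
  | cancel (s : P.SEdge) : Hty s.dom s.dom [s, s.inv] []
  | cell (p q p' q' : P.T) (s s' : P.rels) :
      Hty (p * P.ρτ s.1.1 * q * p' * P.ρτ s'.1.1 * q') (p * P.ρτ s.1.2 * q * p' * P.ρτ s'.1.2 * q')
        [⟨⟨p, s, q * p' * P.ρτ s'.1.1 * q'⟩, true⟩, ⟨⟨p * P.ρτ s.1.2 * q * p', s', q'⟩, true⟩]
        [⟨⟨p * P.ρτ s.1.1 * q * p', s', q'⟩, true⟩, ⟨⟨p, s, q * p' * P.ρτ s'.1.2 * q'⟩, true⟩]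

theorem IsPath.append {a b c : P.T} {k j : List P.SEdge} (h : IsPath a k b) (h' : IsPath b j c) :
    IsPath a (k ++ j) c := by
  induction k generalizing a with
  | nil => cases h; exact h'
  | cons s k ih => exact ⟨h.1, ih h.2⟩

theorem IsPath.lw {a b : P.T} {k : List P.SEdge} (x : P.T) (h : IsPath a k b) :
    IsPath (x * a) (k.map (SEdge.lw x)) (x * b) := by
  induction k generalizing a with
  | nil => exact congrArg (x * ·) h
  | cons s k ih => exact ⟨by rw [SEdge.dom_lw, h.1], by rw [SEdge.cod_lw]; exact ih h.2⟩

theorem IsPath.rw {a b : P.T} {k : List P.SEdge} (x : P.T) (h : IsPath a k b) :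
    IsPath (a * x) (k.map (SEdge.rw x)) (b * x) := by
  induction k generalizing a with
  | nil => exact congrArg (· * x) h
  | cons s k ih => exact ⟨by rw [SEdge.dom_rw, h.1], by rw [SEdge.cod_rw]; exact ih h.2⟩

theorem IsPath.reverse {a b : P.T} {k : List P.SEdge} (h : IsPath a k b) :
    IsPath b (k.map SEdge.inv).reverse a := by
  induction k generalizing a with
  | nil => exact Eq.symm h
  | cons s k ih =>
    rw [List.map_cons, List.reverse_cons]
    exact (ih h.2).append ⟨s.dom_inv, s.cod_inv.trans h.1⟩

theorem IsPath.ψ_eq {a b : P.T} {k : List P.SEdge} (h : IsPath a k b) : P.ψ a = P.ψ b := by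
  induction k generalizing a with
  | nil => exact congrArg _ h
  | cons s k ih =>
    rw [← ih h.2, ← h.1]
    obtain ⟨⟨p, s, q⟩, _ | _⟩ := s <;>
      simp [SEdge.dom, SEdge.cod, Edge.dom, Edge.cod, P.ψ_rel]

theorem Hty.lw {a b : P.T} {k j : List P.SEdge} (x : P.T) (h : Hty a b k j) :
    Hty (x * a) (x * b) (k.map (SEdge.lw x)) (j.map (SEdge.lw x)) := by
  induction h with
  | refl h => exact .refl (h.lw x)
  | symm _ ih => exact ih.symm
  | trans _ _ ih₁ ih₂ => exact ih₁.trans ih₂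
  | append _ _ ih₁ ih₂ => rw [List.map_append, List.map_append]; exact ih₁.append ih₂
  | cancel s => rw [← SEdge.dom_lw]; exact .cancel (s.lw x)
  | cell p q p' q' s s' =>
    have := Hty.cell (x * p) q p' q' s s'
    simp only [mul_assoc] at this
    simpa only [List.map_cons, List.map_nil, SEdge.lw, mul_assoc] using this

theorem Hty.rw {a b : P.T} {k j : List P.SEdge} (x : P.T) (h : Hty a b k j) :
    Hty (a * x) (b * x) (k.map (SEdge.rw x)) (j.map (SEdge.rw x)) := by
  induction h with
  | refl h => exact .refl (h.rw x)
  | symm _ ih => exact ih.symm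
  | trans _ _ ih₁ ih₂ => exact ih₁.trans ih₂
  | append _ _ ih₁ ih₂ => rw [List.map_append, List.map_append]; exact ih₁.append ih₂
  | cancel s => rw [← SEdge.dom_rw]; exact .cancel (s.rw x)
  | cell p q p' q' s s' =>
    have := Hty.cell p q p' (q' * x) s s'
    simp only [mul_assoc] at this
    simpa only [List.map_cons, List.map_nil, SEdge.rw, mul_assoc] using this

theorem Hty.reverse_left {a b : P.T} {k : List P.SEdge} (h : IsPath a k b) :
    Hty b b ((k.map SEdge.inv).reverse ++ k) [] := by
  induction k generalizing a with
  | nil => exact .refl rfl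
  | cons s k ih =>
    have hc : Hty s.cod s.cod [s.inv, s] [] := by
      have := Hty.cancel s.inv
      rwa [s.dom_inv, s.inv_inv] at this
    rw [List.map_cons, List.reverse_cons, List.append_assoc]
    have h₂ : Hty s.cod b ([s.inv, s] ++ k) ([] ++ k) := hc.append (.refl h.2)
    exact ((Hty.refl h.2.reverse).append h₂).trans (ih h.2)

theorem Hty.isPath {a b : P.T} {k j : List P.SEdge} (h : Hty a b k j) :
    IsPath a k b ∧ IsPath a j b := by
  induction h with
  | refl h => exact ⟨h, h⟩
  | symm _ ih => exact ih.symm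
  | trans _ _ ih₁ ih₂ => exact ⟨ih₁.1, ih₂.2⟩
  | append _ _ ih₁ ih₂ => exact ⟨ih₁.1.append ih₂.1, ih₁.2.append ih₂.2⟩
  | cancel s => exact ⟨⟨rfl, s.dom_inv, s.cod_inv⟩, rfl⟩
  | cell p q p' q' s s' =>
    simp [IsPath, SEdge.dom, SEdge.cod, Edge.dom, Edge.cod, mul_assoc]

theorem Hty.reverse {a b : P.T} {k j : List P.SEdge} (h : Hty a b k j) :
    Hty b a (k.map SEdge.inv).reverse (j.map SEdge.inv).reverse := by
  have hp := h.isPath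
  have h₁ : Hty b a ((j.map SEdge.inv).reverse ++ (j ++ (k.map SEdge.inv).reverse))
      (k.map SEdge.inv).reverse := by
    rw [← List.append_assoc]
    exact (Hty.reverse_left hp.2).append (.refl hp.1.reverse)
  have h₂ : Hty a a (k ++ (k.map SEdge.inv).reverse) [] := by
    have := Hty.reverse_left hp.1.reverse
    have hi : (SEdge.inv ∘ SEdge.inv : P.SEdge → P.SEdge) = id := funext SEdge.inv_inv
    rwa [List.map_reverse, List.reverse_reverse, List.map_map, hi, List.map_id] at this
  have h₃ : Hty a a (j ++ (k.map SEdge.inv).reverse) [] :=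
    (h.symm.append (.refl hp.1.reverse)).trans h₂
  have h₄ := (Hty.refl hp.2.reverse).append h₃
  rw [List.append_nil] at h₄
  exact h₁.symm.trans h₄

/-- The interchange property for two edges. -/
theorem Hty.edges (s t : P.SEdge) : Hty (s.dom * t.dom) (s.cod * t.cod)
    [s.rw t.dom, t.lw s.cod] [t.lw s.dom, s.rw t.cod] := by
  have base : ∀ s t : P.Edge, Hty (s.dom * t.dom) (s.cod * t.cod)
      [SEdge.rw t.dom ⟨s, true⟩, SEdge.lw s.cod ⟨t, true⟩]
      [SEdge.lw s.dom ⟨t, true⟩, SEdge.rw t.cod ⟨s, true⟩] := by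
    rintro ⟨p, s, q⟩ ⟨p', s', q'⟩
    have := Hty.cell p q p' q' s s'
    simp only [mul_assoc] at this
    simpa only [SEdge.rw, SEdge.lw, Edge.dom, Edge.cod, mul_assoc] using this
  have left : ∀ s t : P.SEdge, Hty (s.dom * t.dom) (s.cod * t.cod)
      [s.rw t.dom, t.lw s.cod] [t.lw s.dom, s.rw t.cod] →
      Hty (s.inv.dom * t.dom) (s.inv.cod * t.cod)
      [s.inv.rw t.dom, t.lw s.inv.cod] [t.lw s.inv.dom, s.inv.rw t.cod] := by
    intro s t h
    rw [s.dom_inv, s.cod_inv]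
    have e₁ : Hty (s.dom * t.cod) (s.dom * t.cod) [s.rw t.cod, s.inv.rw t.cod] [] :=
      (Hty.cancel s).rw t.cod
    have e₂ : Hty (s.cod * t.dom) (s.cod * t.dom) [s.inv.rw t.dom, s.rw t.dom] [] := by
      have := (Hty.cancel s.inv).rw t.dom
      rwa [s.dom_inv, s.inv_inv] at this
    have p₁ : IsPath (s.cod * t.dom) [s.inv.rw t.dom] (s.dom * t.dom) :=
      ⟨by rw [SEdge.dom_rw, s.dom_inv], by rw [SEdge.cod_rw, s.cod_inv]; rfl⟩
    have p₂ : IsPath (s.cod * t.cod) [s.inv.rw t.cod] (s.dom * t.cod) :=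
      ⟨by rw [SEdge.dom_rw, s.dom_inv], by rw [SEdge.cod_rw, s.cod_inv]; rfl⟩
    have p₃ : IsPath (s.dom * t.dom) [t.lw s.dom] (s.dom * t.cod) :=
      ⟨SEdge.dom_lw _ _, SEdge.cod_lw _ _⟩
    have p₄ : IsPath (s.cod * t.dom) [t.lw s.cod] (s.cod * t.cod) :=
      ⟨SEdge.dom_lw _ _, SEdge.cod_lw _ _⟩
    have m := ((Hty.refl p₁).append h).append (.refl p₂)
    have m₁ := ((Hty.refl p₁).append (.refl p₃)).append e₁
    have m₂ := e₂.append ((Hty.refl p₄).append (.refl p₂))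
    exact m₁.symm.trans (m.symm.trans m₂)
  have right : ∀ s t : P.SEdge, Hty (s.dom * t.dom) (s.cod * t.cod)
      [s.rw t.dom, t.lw s.cod] [t.lw s.dom, s.rw t.cod] →
      Hty (s.dom * t.inv.dom) (s.cod * t.inv.cod)
      [s.rw t.inv.dom, t.inv.lw s.cod] [t.inv.lw s.dom, s.rw t.inv.cod] := by
    intro s t h
    rw [t.dom_inv, t.cod_inv]
    have e₁ : Hty (s.cod * t.dom) (s.cod * t.dom) [t.lw s.cod, t.inv.lw s.cod] [] :=
      (Hty.cancel t).lw s.cod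
    have e₂ : Hty (s.dom * t.cod) (s.dom * t.cod) [t.inv.lw s.dom, t.lw s.dom] [] := by
      have := (Hty.cancel t.inv).lw s.dom
      rwa [t.dom_inv, t.inv_inv] at this
    have p₁ : IsPath (s.dom * t.cod) [t.inv.lw s.dom] (s.dom * t.dom) :=
      ⟨by rw [SEdge.dom_lw, t.dom_inv], by rw [SEdge.cod_lw, t.cod_inv]; rfl⟩
    have p₂ : IsPath (s.cod * t.cod) [t.inv.lw s.cod] (s.cod * t.dom) :=
      ⟨by rw [SEdge.dom_lw, t.dom_inv], by rw [SEdge.cod_lw, t.cod_inv]; rfl⟩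
    have p₃ : IsPath (s.dom * t.dom) [s.rw t.dom] (s.cod * t.dom) :=
      ⟨SEdge.dom_rw _ _, SEdge.cod_rw _ _⟩
    have p₄ : IsPath (s.dom * t.cod) [s.rw t.cod] (s.cod * t.cod) :=
      ⟨SEdge.dom_rw _ _, SEdge.cod_rw _ _⟩
    have m := ((Hty.refl p₁).append h).append (.refl p₂)
    have m₁ := ((Hty.refl p₁).append (.refl p₃)).append e₁
    have m₂ := e₂.append ((Hty.refl p₄).append (.refl p₂))
    exact m₂.symm.trans (m.symm.trans m₁)
  have fwd : ∀ (s : P.SEdge) (t : P.Edge), Hty (s.dom * t.dom) (s.cod * t.cod)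
      [s.rw t.dom, SEdge.lw s.cod ⟨t, true⟩] [SEdge.lw s.dom ⟨t, true⟩, s.rw t.cod] := by
    rintro ⟨s, _ | _⟩ t
    · exact left ⟨s, true⟩ ⟨t, true⟩ (base s t)
    · exact base s t
  obtain ⟨t, _ | _⟩ := t
  · exact right s ⟨t, true⟩ (fwd s t)
  · exact fwd s t

/-- The interchange property for two paths. -/
theorem Hty.interchange {a b c d : P.T} {k j : List P.SEdge} (hk : IsPath a k b)
    (hj : IsPath c j d) : Hty (a * c) (b * d)
      (k.map (SEdge.rw c) ++ j.map (SEdge.lw b)) (j.map (SEdge.lw a) ++ k.map (SEdge.rw d)) := by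
  have single : ∀ (s : P.SEdge) {c : P.T} {j : List P.SEdge}, IsPath c j d →
      Hty (s.dom * c) (s.cod * d) ([s.rw c] ++ j.map (SEdge.lw s.cod))
        (j.map (SEdge.lw s.dom) ++ [s.rw d]) := by
    intro s c j hj
    induction j generalizing c with
    | nil =>
      cases hj
      exact .refl ⟨SEdge.dom_rw _ _, SEdge.cod_rw _ _⟩
    | cons t j ih =>
      obtain ⟨rfl, hj⟩ := hj
      have h₁ : Hty (s.dom * t.dom) (s.cod * d)
          ([s.rw t.dom, t.lw s.cod] ++ j.map (SEdge.lw s.cod))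
          ([t.lw s.dom, s.rw t.cod] ++ j.map (SEdge.lw s.cod)) :=
        (Hty.edges s t).append (.refl (hj.lw s.cod))
      have p : IsPath (s.dom * t.dom) [t.lw s.dom] (s.dom * t.cod) :=
        ⟨SEdge.dom_lw _ _, SEdge.cod_lw _ _⟩
      exact h₁.trans ((Hty.refl p).append (ih hj))
  induction k generalizing a with
  | nil =>
    cases hk
    simpa using Hty.refl (hj.lw _)
  | cons s k ih =>
    obtain ⟨rfl, hk⟩ := hk
    have p : IsPath (s.dom * c) [s.rw c] (s.cod * c) := ⟨SEdge.dom_rw _ _, SEdge.cod_rw _ _⟩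
    have h₁ := (Hty.refl p).append (ih hk)
    have h₂ := (single s hj).append (.refl (hk.rw d))
    rw [List.append_assoc] at h₂
    rw [List.append_assoc] at h₂
    exact h₁.trans h₂

variable (P) in
/-- An edge path in the Squier complex, from the vertex `d` to the vertex `r`. -/
@[ext] structure EdgePath where
  d : P.T
  r : P.T
  edges : List P.SEdge
  isPath : IsPath d edges r

namespace EdgePath

/-- The constant path at a vertex. -/
def const (x : P.T) : P.EdgePath := ⟨x, x, [], rfl⟩

/-- The path consisting of a single edge. -/
def single (s : P.Edge) : P.EdgePath := ⟨s.dom, s.cod, [⟨s, true⟩], rfl, rfl⟩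

/-- Composition of paths. -/
def comp (α β : P.EdgePath) (h : α.r = β.d) : P.EdgePath :=
  ⟨α.d, β.r, α.edges ++ β.edges, α.isPath.append (h ▸ β.isPath)⟩

/-- The reverse path. -/
def symm (α : P.EdgePath) : P.EdgePath :=
  ⟨α.r, α.d, (α.edges.map SEdge.inv).reverse, α.isPath.reverse⟩

/-- The left action `x ▷ α`. -/
def lw (x : P.T) (α : P.EdgePath) : P.EdgePath :=
  ⟨x * α.d, x * α.r, α.edges.map (SEdge.lw x), α.isPath.lw x⟩

/-- The right action `α ◁ x`. -/
def rw (x : P.T) (α : P.EdgePath) : P.EdgePath :=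
  ⟨α.d * x, α.r * x, α.edges.map (SEdge.rw x), α.isPath.rw x⟩

/-- The operation `α ∗ β = (α ◁ β d) ∘ (α r ▷ β)`. -/
def star (α β : P.EdgePath) : P.EdgePath := comp (α.rw β.d) (β.lw α.r) rfl

/-- The operation `α ↦ (α r)⁻¹ ▷ α° ◁ (α d)⁻¹`, where `α°` is the reverse path. -/
def starInv (α : P.EdgePath) : P.EdgePath := (α.symm.rw α.d⁻¹).lw α.r⁻¹

/-- Homotopy of paths relative to the end points. -/
instance homotopy : Setoid P.EdgePath where
  r α β := α.d = β.d ∧ α.r = β.r ∧ Hty α.d α.r α.edges β.edges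
  iseqv :=
    { refl := fun α => ⟨rfl, rfl, .refl α.isPath⟩
      symm := fun {α β} ⟨h₁, h₂, h⟩ => ⟨h₁.symm, h₂.symm, by rw [← h₁, ← h₂]; exact h.symm⟩
      trans := fun {α β γ} ⟨h₁, h₂, h⟩ ⟨k₁, k₂, k⟩ =>
        ⟨h₁.trans k₁, h₂.trans k₂, h.trans (by rw [h₁, h₂]; exact k)⟩ }

theorem lw_congr (x : P.T) {α β : P.EdgePath} (h : α ≈ β) : α.lw x ≈ β.lw x :=
  ⟨congrArg (x * ·) h.1, congrArg (x * ·) h.2.1, h.2.2.lw x⟩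

theorem rw_congr (x : P.T) {α β : P.EdgePath} (h : α ≈ β) : α.rw x ≈ β.rw x :=
  ⟨congrArg (· * x) h.1, congrArg (· * x) h.2.1, h.2.2.rw x⟩

theorem comp_congr {α α' β β' : P.EdgePath} (h : α ≈ α') (k : β ≈ β') (e : α.r = β.d)
    (e' : α'.r = β'.d) : comp α β e ≈ comp α' β' e' :=
  ⟨h.1, k.2.1, h.2.2.append (by rw [e]; exact k.2.2)⟩

theorem symm_congr {α β : P.EdgePath} (h : α ≈ β) : α.symm ≈ β.symm :=
  ⟨h.2.1, h.1, h.2.2.reverse⟩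

theorem star_congr {α α' β β' : P.EdgePath} (h : α ≈ α') (k : β ≈ β') :
    star α β ≈ star α' β' := by
  have h₁ := rw_congr β.d h
  have k₁ := lw_congr α.r k
  rw [show α'.rw β.d = α'.rw β'.d by rw [k.1]] at h₁
  rw [show β'.lw α.r = β'.lw α'.r by rw [h.2.1]] at k₁
  exact comp_congr h₁ k₁ _ _

theorem starInv_congr {α β : P.EdgePath} (h : α ≈ β) : starInv α ≈ starInv β := by
  unfold starInv
  rw [h.1, h.2.1]
  exact lw_congr _ (rw_congr _ (symm_congr h))

theorem lw_lw (x y : P.T) (α : P.EdgePath) : (α.lw y).lw x = α.lw (x * y) := by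
  ext1
  · exact (mul_assoc x y α.d).symm
  · exact (mul_assoc x y α.r).symm
  · simp [lw, Function.comp_def, SEdge.lw_lw]

theorem rw_rw (x y : P.T) (α : P.EdgePath) : (α.rw x).rw y = α.rw (x * y) := by
  ext1
  · exact mul_assoc α.d x y
  · exact mul_assoc α.r x y
  · simp [rw, Function.comp_def, SEdge.rw_rw]

theorem lw_rw (x y : P.T) (α : P.EdgePath) : (α.rw y).lw x = (α.lw x).rw y := by
  ext1
  · exact (mul_assoc x α.d y).symm
  · exact (mul_assoc x α.r y).symm
  · simp [rw, lw, Function.comp_def, SEdge.lw_rw]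

theorem star_assoc (α β γ : P.EdgePath) : star (star α β) γ = star α (star β γ) := by
  ext1
  · exact mul_assoc α.d β.d γ.d
  · exact mul_assoc α.r β.r γ.r
  · simp [star, comp, rw, lw, Function.comp_def, SEdge.rw_rw, SEdge.lw_lw, SEdge.lw_rw]

theorem lw_star (x : P.T) (α β : P.EdgePath) : (star α β).lw x = star (α.lw x) β := by
  ext1
  · exact (mul_assoc x α.d β.d).symm
  · exact (mul_assoc x α.r β.r).symm
  · simp [star, comp, rw, lw, Function.comp_def, SEdge.lw_lw, SEdge.lw_rw]

theorem rw_star (x : P.T) (α β : P.EdgePath) : (star α β).rw x = star α (β.rw x) := by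
  ext1
  · exact mul_assoc α.d β.d x
  · exact mul_assoc α.r β.r x
  · simp [star, comp, rw, lw, Function.comp_def, SEdge.rw_rw, SEdge.lw_rw]

/-- Path-level form of membership in `star_e^⋈`. -/
structure Adapted (e : Idem P.T) (α : P.EdgePath) : Prop where
  d_eq : α.d = e.val
  lw_eq : α.lw e.val = α
  rw_eq : α.rw e.val = α

namespace Adapted

variable {e f : Idem P.T} {α β : P.EdgePath}

theorem r_mem (h : Adapted e α) : α.r * α.r⁻¹ = e.val ∧ α.r⁻¹ * α.r = e.val :=
  P.ψ_ker e.idem (by rw [← α.isPath.ψ_eq, h.d_eq])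

theorem mul_r (h : Adapted e α) : e.val * α.r = α.r := congrArg EdgePath.r h.lw_eq

theorem r_mul (h : Adapted e α) : α.r * e.val = α.r := congrArg EdgePath.r h.rw_eq

theorem mul_inv (h : Adapted e α) : e.val * α.r⁻¹ = α.r⁻¹ := by
  rw [← h.r_mem.2, inv_mul_inv]

theorem inv_mul (h : Adapted e α) : α.r⁻¹ * e.val = α.r⁻¹ := by
  rw [← h.r_mem.1, ← mul_assoc, inv_mul_inv]

theorem const (e : Idem P.T) : Adapted e (const e.val) :=
  ⟨rfl, EdgePath.ext e.idem e.idem rfl, EdgePath.ext e.idem e.idem rfl⟩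

theorem star (h : Adapted e α) (k : Adapted e β) : Adapted e (star α β) :=
  ⟨by
    change α.d * β.d = _
    rw [h.d_eq, k.d_eq, e.idem], by rw [lw_star, h.lw_eq], by rw [rw_star, k.rw_eq]⟩

theorem starInv_eq (h : Adapted e α) : α.starInv = (α.symm.rw e.val).lw α.r⁻¹ := by
  rw [starInv, h.d_eq, idem_inv e.idem]

theorem starInv (h : Adapted e α) : Adapted e α.starInv := by
  rw [h.starInv_eq]
  refine ⟨?_, ?_, ?_⟩
  · change α.r⁻¹ * (α.r * e.val) = _
    rw [h.r_mul, h.r_mem.2]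
  · rw [lw_lw, h.mul_inv]
  · rw [← lw_rw, rw_rw, e.idem]

theorem conj (h : Adapted e α) (g : Arrow e f) : Adapted f ((α.rw g.val).lw g.val⁻¹) := by
  refine ⟨?_, ?_, ?_⟩
  · change g.val⁻¹ * (α.d * g.val) = _
    rw [h.d_eq, g.dom_mul, g.cod]
  · rw [lw_lw, ← g.cod, inv_mul_inv]
  · rw [← lw_rw, rw_rw, g.mul_cod]

theorem const_star (h : Adapted e α) : EdgePath.star (EdgePath.const e.val) α = α :=
  Eq.trans (EdgePath.ext rfl rfl rfl) h.lw_eq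

theorem star_const (h : Adapted e α) : EdgePath.star α (EdgePath.const e.val) = α := by
  have h₁ : EdgePath.star α (EdgePath.const e.val) = α.rw e.val :=
    EdgePath.ext rfl rfl (List.append_nil _)
  rw [h₁, h.rw_eq]

theorem starInv_star (h : Adapted e α) : EdgePath.star α.starInv α ≈ EdgePath.const e.val := by
  have h₁ : EdgePath.star α.starInv α = (comp α.symm α rfl).lw α.r⁻¹ := by
    have hs : α.symm.rw e.val = α.symm := by
      conv_rhs => rw [← h.rw_eq]
      ext1
      · rfl
      · rfl
      · simp [symm, rw, SEdge.rw, SEdge.inv, Function.comp_def]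
    have hr : α.starInv.r = α.r⁻¹ := by
      rw [h.starInv_eq]
      change α.r⁻¹ * (α.d * e.val) = _
      rw [h.d_eq, e.idem, h.inv_mul]
    have h₂ : α.starInv.rw α.d = α.symm.lw α.r⁻¹ := by
      rw [h.d_eq, h.starInv.rw_eq, h.starInv_eq, hs]
    ext1
    · exact (congrArg EdgePath.d h₂ :)
    · change α.starInv.r * α.r = _
      rw [hr]
      rfl
    · change (α.starInv.rw α.d).edges ++ (α.lw α.starInv.r).edges = _
      rw [h₂, hr]
      simp [lw, comp]
  rw [h₁]
  have h₃ : comp α.symm α rfl ≈ EdgePath.const α.r := ⟨rfl, rfl, Hty.reverse_left α.isPath⟩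
  have h₄ : (EdgePath.const α.r).lw α.r⁻¹ = EdgePath.const e.val :=
    EdgePath.ext h.r_mem.2 h.r_mem.2 rfl
  rw [← h₄]
  exact lw_congr _ h₃

theorem conj_star (h : Adapted e α) (g : Arrow e f) :
    ((EdgePath.star α β).rw g.val).lw g.val⁻¹ =
      EdgePath.star ((α.rw g.val).lw g.val⁻¹) ((β.rw g.val).lw g.val⁻¹) := by
  rw [rw_star]
  have hg : g.val * g.val⁻¹ = e.val := g.dom
  have h₀ : EdgePath.star α (β.rw g.val) = EdgePath.star (α.rw g.val) ((β.rw g.val).lw g.val⁻¹) := by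
    have hd : (α.rw g.val).rw (g.val⁻¹ * (β.d * g.val)) = α.rw (β.d * g.val) := by
      rw [rw_rw, ← mul_assoc, hg, ← rw_rw, h.rw_eq]
    have hr : α.r * g.val * g.val⁻¹ = α.r := by rw [mul_assoc, hg, h.r_mul]
    have hl : ((β.rw g.val).lw g.val⁻¹).lw (α.r * g.val) = (β.rw g.val).lw α.r := by
      rw [lw_lw, hr]
    ext1
    · exact (congrArg EdgePath.d hd).symm
    · exact (congrArg EdgePath.r hl).symm
    · exact (congrArg₂ (· ++ ·) (congrArg EdgePath.edges hd) (congrArg EdgePath.edges hl)).symm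
  rw [h₀, lw_star]

theorem peiffer (h : Adapted e α) (k : Adapted e β) :
    EdgePath.star β α ≈ EdgePath.star α ((β.rw α.r).lw α.r⁻¹) := by
  have h₁ : EdgePath.star α ((β.rw α.r).lw α.r⁻¹) =
      comp (α.lw β.d) (β.rw α.r) (by
        change β.d * α.r = β.d * α.r
        rfl) := by
    have hl : ((β.rw α.r).lw α.r⁻¹).lw α.r = β.rw α.r := by
      rw [lw_lw, h.r_mem.1, lw_rw, k.lw_eq]
    have hd : α.rw (α.r⁻¹ * (β.d * α.r)) = α.lw β.d := by
      rw [k.d_eq, h.mul_r, h.r_mem.2, h.rw_eq, h.lw_eq]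
    ext1
    · exact (congrArg EdgePath.d hd :)
    · exact (congrArg EdgePath.r hl :)
    · exact congrArg₂ (· ++ ·) (congrArg EdgePath.edges hd) (congrArg EdgePath.edges hl)
  rw [h₁]
  exact ⟨rfl, rfl, Hty.interchange β.isPath α.isPath⟩

end Adapted

end EdgePath

variable (P) in
/-- The arrows of the fundamental groupoid `π(Sq(P), 𝒯)`. -/
def Pi1 : Type u := Quotient (EdgePath.homotopy (P := P))

namespace Pi1

/-- The homotopy class of a path. -/
def mk (α : P.EdgePath) : P.Pi1 := Quotient.mk _ α

def d : P.Pi1 → P.T := Quotient.lift EdgePath.d fun _ _ h => h.1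

def r : P.Pi1 → P.T := Quotient.lift EdgePath.r fun _ _ h => h.2.1

def lw (x : P.T) : P.Pi1 → P.Pi1 := Quotient.map (EdgePath.lw x) fun _ _ h => EdgePath.lw_congr x h

def rw (x : P.T) : P.Pi1 → P.Pi1 := Quotient.map (EdgePath.rw x) fun _ _ h => EdgePath.rw_congr x h

def star : P.Pi1 → P.Pi1 → P.Pi1 :=
  Quotient.map₂ EdgePath.star fun _ _ h _ _ k => EdgePath.star_congr h k

def starInv : P.Pi1 → P.Pi1 :=
  Quotient.map EdgePath.starInv fun _ _ h => EdgePath.starInv_congr h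

end Pi1

/-- The set `star_e^⋈ = {e ▷ β ◁ e : β d = e}`. -/
def StarBow (e : Idem P.T) : Type u :=
  {α : P.Pi1 // ∃ β : P.Pi1, β.d = e.val ∧ α = (β.rw e.val).lw e.val}

namespace StarBow

variable {e f : Idem P.T}

theorem mem_of_adapted {α : P.EdgePath} (h : EdgePath.Adapted e α) :
    ∃ β : P.Pi1, β.d = e.val ∧ Pi1.mk α = (β.rw e.val).lw e.val :=
  ⟨Pi1.mk α, h.d_eq, congrArg Pi1.mk (by rw [h.rw_eq, h.lw_eq])⟩

theorem exists_adapted (α : StarBow e) :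
    ∃ a : P.EdgePath, EdgePath.Adapted e a ∧ Pi1.mk a = α.1 := by
  obtain ⟨_, ⟨⟨b⟩, hd, rfl⟩⟩ := α
  have hd' : b.d = e.val := hd
  refine ⟨(b.rw e.val).lw e.val, ⟨?_, ?_, ?_⟩, rfl⟩
  · change e.val * (b.d * e.val) = _
    rw [hd', e.idem, e.idem]
  · rw [EdgePath.lw_lw, e.idem]
  · rw [← EdgePath.lw_rw, EdgePath.rw_rw, e.idem]

/-- The group `(star_e^⋈, ∗)`. -/
instance group (e : Idem P.T) : Group (StarBow e) where
  mul α β := ⟨Pi1.star α.1 β.1, by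
    obtain ⟨a, ha, ha'⟩ := α.exists_adapted
    obtain ⟨b, hb, hb'⟩ := β.exists_adapted
    rw [← ha', ← hb']
    exact mem_of_adapted (ha.star hb)⟩
  one := ⟨Pi1.mk (EdgePath.const e.val), mem_of_adapted (.const e)⟩
  inv α := ⟨Pi1.starInv α.1, by
    obtain ⟨a, ha, ha'⟩ := α.exists_adapted
    rw [← ha']
    exact mem_of_adapted ha.starInv⟩
  mul_assoc := by
    rintro ⟨⟨a⟩, _⟩ ⟨⟨b⟩, _⟩ ⟨⟨c⟩, _⟩
    exact Subtype.ext (congrArg Pi1.mk (EdgePath.star_assoc a b c))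
  one_mul α := by
    obtain ⟨a, ha, ha'⟩ := α.exists_adapted
    refine Subtype.ext ?_
    change Pi1.star (Pi1.mk (EdgePath.const e.val)) α.1 = α.1
    rw [← ha']
    exact congrArg Pi1.mk ha.const_star
  mul_one α := by
    obtain ⟨a, ha, ha'⟩ := α.exists_adapted
    refine Subtype.ext ?_
    change Pi1.star α.1 (Pi1.mk (EdgePath.const e.val)) = α.1
    rw [← ha']
    exact congrArg Pi1.mk ha.star_const
  inv_mul_cancel α := by
    obtain ⟨a, ha, ha'⟩ := α.exists_adapted
    refine Subtype.ext ?_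
    change Pi1.star (Pi1.starInv α.1) α.1 = Pi1.mk (EdgePath.const e.val)
    rw [← ha']
    exact Quotient.sound ha.starInv_star

/-- The range map `star_e^⋈ → 𝒯`, which takes values in the vertex group at `e`. -/
def bd (e : Idem P.T) : StarBow e →* (e ⟶ e) where
  toFun α := (⟨α.1.r, by
      obtain ⟨a, ha, ha'⟩ := α.exists_adapted
      rw [← ha']
      exact ha.r_mem.1, by
      obtain ⟨a, ha, ha'⟩ := α.exists_adapted
      rw [← ha']
      exact ha.r_mem.2⟩ : Arrow e e)
  map_one' := rfl
  map_mul' := by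
    rintro ⟨⟨a⟩, _⟩ ⟨⟨b⟩, _⟩
    rfl

/-- The action `α^g = g⁻¹ ▷ α ◁ g`. -/
def act (g : e ⟶ f) : StarBow e →* StarBow f :=
  MonoidHom.mk' (fun α => ⟨(α.1.rw (Arrow.val g)).lw (Arrow.val g)⁻¹, by
      obtain ⟨a, ha, ha'⟩ := α.exists_adapted
      rw [← ha']
      exact mem_of_adapted (ha.conj g)⟩) (by
    intro α β
    obtain ⟨a, ha, ha'⟩ := α.exists_adapted
    obtain ⟨b, hb, hb'⟩ := β.exists_adapted
    refine Subtype.ext ?_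
    change ((Pi1.star α.1 β.1).rw _).lw _ = Pi1.star ((α.1.rw _).lw _) ((β.1.rw _).lw _)
    rw [← ha', ← hb']
    exact congrArg Pi1.mk (ha.conj_star g))

end StarBow

variable (P) in
/-- The crossed module `S^⋈ → 𝒯 ⇉ E(𝒯)`. -/
def starCM : CrossedModule.{u, u, u} (Idem P.T) where
  C e := StarBow e
  bd e := StarBow.bd e
  act g := StarBow.act g
  act_id e α := by
    obtain ⟨a, ha, ha'⟩ := α.exists_adapted
    refine Subtype.ext ?_
    change (α.1.rw e.val).lw e.val⁻¹ = α.1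
    rw [← ha', idem_inv e.idem]
    exact congrArg Pi1.mk (by rw [ha.rw_eq, ha.lw_eq])
  act_comp g h α := by
    obtain ⟨a, ha, ha'⟩ := α.exists_adapted
    refine Subtype.ext ?_
    change (α.1.rw (Arrow.val g * Arrow.val h)).lw (Arrow.val g * Arrow.val h)⁻¹ =
      (((α.1.rw (Arrow.val g)).lw (Arrow.val g)⁻¹).rw (Arrow.val h)).lw (Arrow.val h)⁻¹
    rw [← ha', mul_inv']
    refine congrArg Pi1.mk ?_
    rw [← EdgePath.lw_rw, EdgePath.rw_rw, EdgePath.lw_lw]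
  bd_act g α := by
    obtain ⟨⟨a⟩, _⟩ := α
    rfl
  act_bd {e} α β := by
    rw [mul_assoc, eq_inv_mul_iff_mul_eq]
    obtain ⟨a, ha, ha'⟩ := α.exists_adapted
    obtain ⟨b, hb, hb'⟩ := β.exists_adapted
    refine Subtype.ext ?_
    change Pi1.star α.1 ((β.1.rw α.1.r).lw α.1.r⁻¹) = Pi1.star β.1 α.1
    rw [← ha', ← hb']
    exact (Quotient.sound (ha.peiffer hb)).symm

/-! #### The basis -/

variable (P) in
/-- The set `R` of triples `(l, r, x)` with `(l, r)` a relation and `x` an idempotent of `𝒯` such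
that `(l⁻¹ r) ρ τ ψ ≥ x ψ`. -/
structure Basis where
  rel : P.rels
  x : Idem P.T
  le : NatLE (P.ψ x.val) (P.ψ (P.ρτ (wordInv rel.1.1 * rel.1.2)))

/-- The loop `(l, r, x) ω = x ((l⁻¹ r) ρ τ) x` at `x`. -/
def ω (s : P.Basis) : s.x ⟶ s.x :=
  have h : P.ψ (s.x.val * P.ρτ (wordInv s.rel.1.1 * s.rel.1.2) * s.x.val) = P.ψ s.x.val := by
    obtain ⟨f, hf, h⟩ := s.le
    have hm : P.ψ (P.ρτ (wordInv s.rel.1.1 * s.rel.1.2)) =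
        (P.ψ (P.ρτ s.rel.1.1))⁻¹ * P.ψ (P.ρτ s.rel.1.1) := by
      rw [map_mul, map_mul, ← P.ψ_rel, P.ρτ_wordInv, map_inv']
    have hi := idem_inv_mul (P.ψ (P.ρτ s.rel.1.1))
    rw [← hm] at hi
    rw [map_mul, map_mul, mul_assoc]
    nth_rewrite 2 [h]
    rw [← mul_assoc (P.ψ (P.ρτ _)), hi, ← h, ← map_mul, s.x.idem]
  (⟨s.x.val * P.ρτ (wordInv s.rel.1.1 * s.rel.1.2) * s.x.val,
    (P.ψ_ker s.x.idem h).1, (P.ψ_ker s.x.idem h).2⟩ : Arrow s.x s.x)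

variable (P) in
/-- The free crossed `𝒯`-module with basis `ω`, as constructed from free groups. -/
def freeCM : CrossedModule.{u, u, u} (Idem P.T) := CrossedModule.free Basis.x (ω (P := P))

/-- The basis elements of the free crossed `𝒯`-module. -/
def freeCMBasis (s : P.Basis) : P.freeCM.C s.x := CrossedModule.freeBasis Basis.x ω s

/-- The class in `π(Sq(P), 𝒯)` of the edge `(x h⁻¹, l, r, x)`, where `h = l ρ τ`. -/
def basisEdge (s : P.Basis) : P.Pi1 :=
  Pi1.mk (EdgePath.single ⟨s.x.val * (P.ρτ s.rel.1.1)⁻¹, s.rel, s.x.val⟩)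

end InvPresentation

end Presentation

/-!
The isomorphism is induced by the basis edges, and its inverse is read off from edge paths. Over the
fibre of `ψ` at `e ψ`, an edge `(p, l, r, q)` determines the free generator `((l, r, x), q e)` with
`x = (q e)(q e)⁻¹`, whatever `p` is, because `ψ` separates idempotents. Multiplying these generators
along a path gives an element of `C_e` that depends only on the homotopy class: the `2`-cells of the
Squier complex become the Peiffer relations. In the other direction, every path `α` over this
fibre has a normal form `(α d)⁻¹ ▷ α ◁ e` in `star_e^⋈`. Normalisation turns composition of paths
into `∗`, so it is enough to see on single edges that the generators attached to `α` are sent to the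
normal form of `α`, and elements of `star_e^⋈` are their own normal forms.
-/

namespace CrossedModule

universe w₂

variable {V : Type u} [Groupoid.{v} V]

theorem mul_act_bd (A : CrossedModule.{u, v, w} V) {e : V} (a c : A.C e) :
    a * A.act (A.bd e a) c = c * a := by
  rw [A.act_bd, mul_assoc, mul_inv_cancel_left]

section FreeLift

variable {R : Type w} {b : R → V} (ω : ∀ r, b r ⟶ b r) {e f : V}

/-- The class in the free crossed module of a generator `(r, g)` of the free group. -/
def freeOf (s : FreeGen b e) : (free b ω).C e :=
  QuotientGroup.mk' (peiffer b ω e) (FreeGroup.of s)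

theorem bd_freeOf (s : FreeGen b e) :
    (free b ω).bd e (freeOf ω s) = Groupoid.inv s.snd ≫ ω s.fst ≫ s.snd :=
  freeBd_of b ω e s

theorem act_freeOf (g : e ⟶ f) (s : FreeGen b e) :
    (free b ω).act g (freeOf ω s) = freeOf ω ⟨s.fst, s.snd ≫ g⟩ :=
  congrArg (QuotientGroup.mk' (peiffer b ω f)) (freeAct_of b g s)

theorem act_freeBasis (s : FreeGen b e) :
    (free b ω).act s.snd (freeBasis b ω s.fst) = freeOf ω s :=
  (act_freeOf ω s.snd ⟨s.fst, 𝟙 _⟩).trans (by rw [Category.id_comp])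

theorem bd_freeBasis (r : R) : (free b ω).bd (b r) (freeBasis b ω r) = ω r :=
  (bd_freeOf ω ⟨r, 𝟙 (b r)⟩).trans (by simp [Groupoid.inv_eq_inv])

variable {ω}

theorem free_monoidHom_ext {G : Type*} [Monoid G] {φ χ : (free b ω).C e →* G}
    (h : ∀ s, φ (freeOf ω s) = χ (freeOf ω s)) : φ = χ :=
  QuotientGroup.monoidHom_ext _ (FreeGroup.ext_hom _ _ h)

variable {B : CrossedModule.{u, v, w₂} V}

/-- The homomorphism out of the free pre-crossed module induced by a choice of images of the
basis. -/
def freeGroupLift (σ : ∀ r, B.C (b r)) (e : V) : FreeGroup (FreeGen b e) →* B.C e :=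
  FreeGroup.lift fun s => B.act s.snd (σ s.fst)

theorem freeGroupLift_of (σ : ∀ r, B.C (b r)) (s : FreeGen b e) :
    freeGroupLift σ e (FreeGroup.of s) = B.act s.snd (σ s.fst) :=
  FreeGroup.lift_apply_of

theorem bd_freeGroupLift {σ : ∀ r, B.C (b r)} (hσ : ∀ r, B.bd (b r) (σ r) = ω r)
    (x : FreeGroup (FreeGen b e)) : B.bd e (freeGroupLift σ e x) = freeBd b ω e x := by
  have h : (B.bd e).comp (freeGroupLift σ e) = freeBd b ω e := by
    refine FreeGroup.ext_hom _ _ fun s => ?_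
    rw [MonoidHom.comp_apply, freeGroupLift_of, B.bd_act, hσ, freeBd_of]
  exact DFunLike.congr_fun h x

theorem freeGroupLift_freeAct (σ : ∀ r, B.C (b r)) (g : e ⟶ f) (x : FreeGroup (FreeGen b e)) :
    freeGroupLift σ f (freeAct b g x) = B.act g (freeGroupLift σ e x) := by
  have h : (freeGroupLift σ f).comp (freeAct b g) = (B.act g).comp (freeGroupLift σ e) := by
    refine FreeGroup.ext_hom _ _ fun s => ?_
    rw [MonoidHom.comp_apply, freeAct_of, freeGroupLift_of, MonoidHom.comp_apply,
      freeGroupLift_of, B.act_comp]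
  exact DFunLike.congr_fun h x

theorem peiffer_le_ker_freeGroupLift {σ : ∀ r, B.C (b r)} (hσ : ∀ r, B.bd (b r) (σ r) = ω r)
    (e : V) : peiffer b ω e ≤ (freeGroupLift σ e).ker := by
  refine (Subgroup.closure_le _).2 ?_
  rintro _ ⟨u, v, rfl⟩
  rw [SetLike.mem_coe, MonoidHom.mem_ker, map_mul, freeGroupLift_freeAct, ← bd_freeGroupLift hσ,
    B.act_bd, map_mul, map_mul, map_inv, map_inv]
  group

/-- The morphism out of the free crossed module induced by a choice of images of the basis. -/
def freeLift (σ : ∀ r, B.C (b r)) (hσ : ∀ r, B.bd (b r) (σ r) = ω r) : Hom (free b ω) B where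
  map e := QuotientGroup.lift (peiffer b ω e) (freeGroupLift σ e)
    (peiffer_le_ker_freeGroupLift hσ e)
  bd_map _ := by
    rintro ⟨x⟩
    exact bd_freeGroupLift hσ x
  act_map g := by
    rintro ⟨x⟩
    exact freeGroupLift_freeAct σ g x

theorem freeLift_freeOf {σ : ∀ r, B.C (b r)} (hσ : ∀ r, B.bd (b r) (σ r) = ω r)
    (s : FreeGen b e) : (freeLift σ hσ).map e (freeOf ω s) = B.act s.snd (σ s.fst) :=
  freeGroupLift_of σ s

theorem freeLift_freeBasis {σ : ∀ r, B.C (b r)} (hσ : ∀ r, B.bd (b r) (σ r) = ω r) (r : R) :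
    (freeLift σ hσ).map (b r) (freeBasis b ω r) = σ r :=
  (freeLift_freeOf hσ _).trans (B.act_id _ _)

theorem eq_freeLift {σ : ∀ r, B.C (b r)} (hσ : ∀ r, B.bd (b r) (σ r) = ω r)
    {φ : Hom (free b ω) B} (hφ : ∀ r, φ.map (b r) (freeBasis b ω r) = σ r) :
    φ = freeLift σ hσ :=
  Hom.ext <| funext fun _ => free_monoidHom_ext fun s => by
    rw [freeLift_freeOf, ← act_freeBasis, φ.act_map, hφ]

variable (b ω) in
theorem free_isFreeOn : IsFreeOn.{u, v, w, max v w, w₂} (free b ω) b ω (freeBasis b ω) :=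
  ⟨bd_freeBasis ω, fun _ σ hσ =>
    ⟨freeLift σ hσ, freeLift_freeBasis hσ, fun _ hφ => eq_freeLift hσ hφ⟩⟩

end FreeLift

end CrossedModule

namespace InverseMonoid

variable {S : Type u} [InverseMonoid S]

/-- A homomorphism that is injective on idempotents. -/
def IdempotentSeparating {N : Type v} [Monoid N] (φ : S →* N) : Prop :=
  ∀ ⦃e f : S⦄, e * e = e → f * f = f → φ e = φ f → e = f

namespace IdempotentSeparating

variable {N : Type v} [Monoid N] {φ : S →* N}

theorem idem_mul_eq_right (hφ : IdempotentSeparating φ) {f a : S} (hf : f * f = f)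
    (h : φ (f * a) = φ a) : f * a = a := by
  have hfa : f * (a * a⁻¹) = a * a⁻¹ := by
    refine hφ (idem_mul hf (idem_mul_inv a)) (idem_mul_inv a) ?_
    rw [← mul_assoc, map_mul, h, ← map_mul]
  calc f * a = f * (a * a⁻¹) * a := by rw [mul_assoc f, mul_inv_mul]
    _ = a := by rw [hfa, mul_inv_mul]

theorem mul_inv_mul_eq_right (hφ : IdempotentSeparating φ) {a b : S} (h : φ a = φ b) :
    a * a⁻¹ * b = b :=
  hφ.idem_mul_eq_right (idem_mul_inv a) (by rw [map_mul, ← h, ← map_mul, mul_inv_mul])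

end IdempotentSeparating

section RightFactor

variable {e p c : S}

theorem inv_mul_self_of_right_factor (h : (p * c)⁻¹ * (p * c) = e) (hc : c * e = c) :
    c⁻¹ * c = e := by
  have he : e * e = e := by rw [← h, idem_inv_mul]
  have hle : e * (c⁻¹ * c) = e := by
    rw [← h, mul_assoc, mul_assoc p, ← mul_assoc c, mul_inv_mul]
  rw [← hle, idem_comm he (idem_inv_mul c), mul_assoc, hc]

theorem inv_mul_mul_of_right_factor (h : (p * c)⁻¹ * (p * c) = e) (hc : c * e = c) :
    p⁻¹ * p * c = c := by
  have hconj : c⁻¹ * (p⁻¹ * p) * c = e := by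
    rw [← h, mul_inv']
    simp only [mul_assoc]
  calc p⁻¹ * p * c = p⁻¹ * p * (c * c⁻¹) * c := by rw [mul_assoc (p⁻¹ * p), mul_inv_mul]
    _ = c * (c⁻¹ * (p⁻¹ * p) * c) := by
        rw [idem_comm (idem_inv_mul p) (idem_mul_inv c)]
        simp only [mul_assoc]
    _ = c := by rw [hconj, hc]

theorem inv_mul_of_right_factor (h : (p * c)⁻¹ * (p * c) = e) (hc : c * e = c) :
    (p * c)⁻¹ * p = c⁻¹ := by
  rw [mul_inv', mul_assoc, ← idem_inv (idem_inv_mul p), ← mul_inv',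
    inv_mul_mul_of_right_factor h hc]

end RightFactor

end InverseMonoid

section Presentation

open InverseMonoid

namespace InvPresentation

variable {X : Type u} {M : Type v} [InverseMonoid M] {P : InvPresentation X M} {e : Idem P.T}

variable (P) in
theorem ψ_idempotentSeparating : IdempotentSeparating P.ψ := fun _ _ => P.ψ_idem

theorem mul_idem_of_ψ_eq {a : P.T} (h : P.ψ a = P.ψ e.val) : a * e.val = a := by
  rw [← (P.ψ_ker e.idem h).2, ← mul_assoc, mul_inv_mul]

theorem inv_mul_idem_of_ψ_eq {a : P.T} (h : P.ψ a = P.ψ e.val) : a⁻¹ * e.val = a⁻¹ := by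
  rw [← (P.ψ_ker e.idem h).1, ← mul_assoc, inv_mul_inv]

theorem idem_mul_inv_of_ψ_eq {a : P.T} (h : P.ψ a = P.ψ e.val) : e.val * a⁻¹ = a⁻¹ := by
  rw [← (P.ψ_ker e.idem h).2, inv_mul_inv]

theorem ψ_wordInv_mul_rel (s : P.rels) : P.ψ (P.ρτ (wordInv s.1.1 * s.1.2)) =
    P.ψ ((P.ρτ s.1.1)⁻¹ * P.ρτ s.1.1) := by
  rw [map_mul, map_mul, ← P.ψ_rel, P.ρτ_wordInv, ← map_mul]

theorem natLE_iff_inv_mul_mul (s : P.rels) (x : Idem P.T) :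
    NatLE (P.ψ x.val) (P.ψ (P.ρτ (wordInv s.1.1 * s.1.2))) ↔
      (P.ρτ s.1.1)⁻¹ * P.ρτ s.1.1 * x.val = x.val := by
  rw [ψ_wordInv_mul_rel]
  constructor
  · rintro ⟨f, -, h⟩
    refine P.ψ_idempotentSeparating.idem_mul_eq_right (idem_inv_mul _) ?_
    rw [map_mul, h, ← mul_assoc, ← map_mul, idem_inv_mul]
  · exact fun h => ⟨P.ψ x.val, by rw [← map_mul, x.idem], by rw [← map_mul, h]⟩

namespace EdgePath

theorem induction {motive : P.EdgePath → Prop} (const : ∀ x, motive (const x))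
    (single : ∀ s, motive (single s)) (symm : ∀ α, motive α → motive α.symm)
    (comp : ∀ α β h, motive α → motive β → motive (comp α β h)) (α : P.EdgePath) : motive α := by
  obtain ⟨a, b, k, hk⟩ := α
  induction k generalizing a with
  | nil =>
    obtain rfl : a = b := hk
    exact const a
  | cons s k ih =>
    obtain ⟨rfl, hk⟩ := hk
    have hs : motive ⟨s.dom, s.cod, [s], rfl, rfl⟩ := by
      obtain ⟨s, _ | _⟩ := s
      · exact symm _ (single s)
      · exact single s
    exact comp _ ⟨s.cod, b, k, hk⟩ rfl hs (ih s.cod hk)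

theorem lw_single (x p : P.T) (s : P.rels) (q : P.T) :
    (single ⟨p, s, q⟩).lw x = single ⟨x * p, s, q⟩ :=
  EdgePath.ext (SEdge.dom_lw x ⟨⟨p, s, q⟩, true⟩).symm (SEdge.cod_lw x ⟨⟨p, s, q⟩, true⟩).symm rfl

theorem rw_single (x p : P.T) (s : P.rels) (q : P.T) :
    (single ⟨p, s, q⟩).rw x = single ⟨p, s, q * x⟩ :=
  EdgePath.ext (SEdge.dom_rw x ⟨⟨p, s, q⟩, true⟩).symm (SEdge.cod_rw x ⟨⟨p, s, q⟩, true⟩).symm rfl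

/-- The normal form `(α d)⁻¹ ▷ α ◁ e` of a path `α` over the fibre of `ψ` at `e ψ`. It starts
at `e`. -/
def normalForm (e : Idem P.T) (α : P.EdgePath) : P.EdgePath := (α.rw e.val).lw α.d⁻¹

theorem normalForm_adapted {α : P.EdgePath} (h : P.ψ α.d = P.ψ e.val) :
    Adapted e (α.normalForm e) where
  d_eq := by
    change α.d⁻¹ * (α.d * e.val) = e.val
    rw [← mul_assoc, (P.ψ_ker e.idem h).2, e.idem]
  lw_eq := by rw [normalForm, lw_lw, idem_mul_inv_of_ψ_eq h]
  rw_eq := by rw [normalForm, ← lw_rw, rw_rw, e.idem]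

theorem Adapted.normalForm_eq {α : P.EdgePath} (h : Adapted e α) : α.normalForm e = α := by
  rw [normalForm, h.rw_eq, h.d_eq, idem_inv e.idem, h.lw_eq]

theorem normalForm_comp {α β : P.EdgePath} (h : P.ψ α.d = P.ψ e.val) (hαβ : α.r = β.d) :
    (comp α β hαβ).normalForm e = star (α.normalForm e) (β.normalForm e) := by
  have hr : P.ψ α.r = P.ψ e.val := α.isPath.ψ_eq.symm.trans h
  have hα : (α.normalForm e).rw (β.normalForm e).d = α.normalForm e := by
    rw [(normalForm_adapted (hαβ ▸ hr)).d_eq, (normalForm_adapted h).rw_eq]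
  have hβ : (β.normalForm e).lw (α.normalForm e).r = (β.rw e.val).lw α.d⁻¹ := by
    have hvertex : α.d⁻¹ * (α.r * e.val) * β.d⁻¹ = α.d⁻¹ := by
      rw [mul_idem_of_ψ_eq hr, ← hαβ, mul_assoc, (P.ψ_ker e.idem hr).1, inv_mul_idem_of_ψ_eq h]
    change ((β.rw e.val).lw β.d⁻¹).lw (α.d⁻¹ * (α.r * e.val)) = _
    rw [lw_lw, hvertex]
  refine EdgePath.ext (congrArg EdgePath.d hα).symm (congrArg EdgePath.r hβ).symm ?_
  change _ = ((α.normalForm e).rw (β.normalForm e).d).edges ++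
    ((β.normalForm e).lw (α.normalForm e).r).edges
  rw [hα, hβ]
  exact (congrArg _ List.map_append).trans List.map_append

end EdgePath

namespace StarBow

open EdgePath

/-- The class in `star_e^⋈` of the normal form of a path over the fibre of `ψ` at `e ψ`. -/
def ofPath (e : Idem P.T) (α : P.EdgePath) (h : P.ψ α.d = P.ψ e.val) : StarBow e :=
  ⟨Pi1.mk (α.normalForm e), mem_of_adapted (normalForm_adapted h)⟩

theorem ofPath_congr {α β : P.EdgePath} (hαβ : α ≈ β) (h : P.ψ α.d = P.ψ e.val) :
    ofPath e α h = ofPath e β (hαβ.1 ▸ h) := by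
  refine Subtype.ext (Quotient.sound ?_)
  rw [normalForm, normalForm, hαβ.1]
  exact lw_congr _ (rw_congr _ hαβ)

theorem ofPath_const {x : P.T} (h : P.ψ x = P.ψ e.val) : ofPath e (const x) h = 1 := by
  have hx : x⁻¹ * (x * e.val) = e.val := (normalForm_adapted (α := const x) h).d_eq
  exact Subtype.ext (congrArg Pi1.mk (EdgePath.ext hx hx rfl))

theorem ofPath_comp {α β : P.EdgePath} (hαβ : α.r = β.d) (h : P.ψ α.d = P.ψ e.val) :
    ofPath e (comp α β hαβ) h =
      ofPath e α h * ofPath e β (by rw [← hαβ, ← α.isPath.ψ_eq, h]) :=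
  Subtype.ext (congrArg Pi1.mk (normalForm_comp h hαβ))

theorem ofPath_symm {α : P.EdgePath} (h : P.ψ α.symm.d = P.ψ e.val) :
    ofPath e α.symm h = (ofPath e α (α.isPath.ψ_eq.trans h))⁻¹ := by
  have hcancel : comp α.symm α rfl ≈ const α.r := ⟨rfl, rfl, Hty.reverse_left α.isPath⟩
  exact eq_inv_of_mul_eq_one_left <|
    (ofPath_comp rfl h).symm.trans ((ofPath_congr hcancel h).trans (ofPath_const _))

end StarBow

/-! #### From the free crossed module to `S^⋈` -/

theorem basisEdge_adapted (s : P.Basis) : EdgePath.Adapted s.x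
    (EdgePath.single ⟨s.x.val * (P.ρτ s.rel.1.1)⁻¹, s.rel, s.x.val⟩) where
  d_eq := by
    change s.x.val * (P.ρτ s.rel.1.1)⁻¹ * P.ρτ s.rel.1.1 * s.x.val = s.x.val
    rw [mul_assoc s.x.val, mul_assoc, (natLE_iff_inv_mul_mul _ _).1 s.le, s.x.idem]
  lw_eq := by rw [EdgePath.lw_single, ← mul_assoc, s.x.idem]
  rw_eq := by rw [EdgePath.rw_single, s.x.idem]

/-- The class of the edge `(x h⁻¹, l, r, x)`, where `h = l ρ τ`, as an element of `star_x^⋈`. -/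
def basisStar (s : P.Basis) : P.starCM.C s.x :=
  (⟨basisEdge s, StarBow.mem_of_adapted (basisEdge_adapted s)⟩ : StarBow s.x)

theorem bd_basisStar (s : P.Basis) : P.starCM.bd s.x (basisStar s) = ω s := by
  refine Arrow.ext ?_
  change s.x.val * (P.ρτ s.rel.1.1)⁻¹ * P.ρτ s.rel.1.2 * s.x.val =
    s.x.val * P.ρτ (wordInv s.rel.1.1 * s.rel.1.2) * s.x.val
  rw [map_mul, P.ρτ_wordInv, ← mul_assoc]

variable (P) in
/-- The morphism from the free crossed module to `S^⋈` induced by the basis edges. -/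
def toStar : CrossedModule.Hom P.freeCM P.starCM :=
  CrossedModule.freeLift basisStar bd_basisStar

theorem toStar_freeCMBasis (s : P.Basis) : P.toStar.map s.x (freeCMBasis s) = basisStar s :=
  CrossedModule.freeLift_freeBasis bd_basisStar s

/-- The class in `C_e` of a generator `((l, r, x), g)` of `F_e`. -/
def freeCMOf (t : CrossedModule.FreeGen (Basis.x (P := P)) e) : P.freeCM.C e :=
  CrossedModule.freeOf ω t

theorem toStar_freeCMOf (t : CrossedModule.FreeGen (Basis.x (P := P)) e) :
    (P.toStar.map e (freeCMOf t) : StarBow e).1 =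
      Pi1.mk (EdgePath.single ⟨(P.ρτ t.fst.rel.1.1 * Arrow.val t.snd)⁻¹, t.fst.rel,
        Arrow.val t.snd⟩) := by
  have hact : P.toStar.map e (freeCMOf t) = P.starCM.act t.snd (basisStar t.fst) :=
    CrossedModule.freeLift_freeOf bd_basisStar t
  have hinv : (Arrow.val t.snd)⁻¹ * t.fst.x.val = (Arrow.val t.snd)⁻¹ := by
    rw [← Arrow.dom t.snd, ← mul_assoc, inv_mul_inv]
  rw [hact]
  change Pi1.mk (((EdgePath.single _).rw (Arrow.val t.snd)).lw (Arrow.val t.snd)⁻¹) = _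
  rw [EdgePath.rw_single, EdgePath.lw_single, Arrow.dom_mul, ← mul_assoc, hinv, mul_inv']

theorem bd_freeCMOf_val (t : CrossedModule.FreeGen (Basis.x (P := P)) e) :
    Arrow.val (P.freeCM.bd e (freeCMOf t)) =
      (P.ρτ t.fst.rel.1.1 * Arrow.val t.snd)⁻¹ * (P.ρτ t.fst.rel.1.2 * Arrow.val t.snd) := by
  set g := Arrow.val t.snd
  have hxg : t.fst.x.val * g = g := Arrow.dom_mul t.snd
  have hgx : g⁻¹ * t.fst.x.val = g⁻¹ := by rw [← Arrow.dom t.snd, ← mul_assoc, inv_mul_inv]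
  calc Arrow.val (P.freeCM.bd e (freeCMOf t))
      = g⁻¹ * (t.fst.x.val * P.ρτ (wordInv t.fst.rel.1.1 * t.fst.rel.1.2) * t.fst.x.val * g) :=
        congrArg Arrow.val (CrossedModule.bd_freeOf ω t)
    _ = g⁻¹ * t.fst.x.val * P.ρτ (wordInv t.fst.rel.1.1 * t.fst.rel.1.2) * (t.fst.x.val * g) := by
        simp only [mul_assoc]
    _ = (P.ρτ t.fst.rel.1.1 * g)⁻¹ * (P.ρτ t.fst.rel.1.2 * g) := by
        rw [hxg, hgx, map_mul, P.ρτ_wordInv, mul_inv']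
        simp only [mul_assoc]

theorem freeGen_ext {t t' : CrossedModule.FreeGen (Basis.x (P := P)) e}
    (hrel : t.fst.rel = t'.fst.rel) (hval : Arrow.val t.snd = Arrow.val t'.snd) : t = t' := by
  obtain ⟨⟨r, x, hx⟩, g⟩ := t
  obtain ⟨⟨r', x', hx'⟩, g'⟩ := t'
  obtain rfl : r = r' := hrel
  obtain rfl : x = x' := Idem.ext (by
    rw [← Arrow.dom g, ← Arrow.dom g']
    exact congrArg (fun a => a * a⁻¹) hval)
  obtain rfl : g = g' := Arrow.ext hval
  rfl

/-- The condition on `g` for `((l, r, g g⁻¹), g)` to be a generator of `F_e`: the arrow `g` ends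
at `e` and starts at an idempotent below `h⁻¹ h`, where `h = l ρ τ`. -/
structure IsGenerator (e : Idem P.T) (s : P.rels) (g : P.T) : Prop where
  cod : g⁻¹ * g = e.val
  inv_mul_mul : (P.ρτ s.1.1)⁻¹ * P.ρτ s.1.1 * g = g

namespace IsGenerator

variable {s s' : P.rels} {g : P.T}

/-- The generator `((l, r, g g⁻¹), g)` of `F_e`. -/
def gen (H : IsGenerator e s g) : CrossedModule.FreeGen (Basis.x (P := P)) e where
  fst := ⟨s, ⟨g * g⁻¹, idem_mul_inv g⟩,
    (natLE_iff_inv_mul_mul _ _).2 (by rw [← mul_assoc, H.inv_mul_mul])⟩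
  snd := (⟨g, rfl, H.cod⟩ : Arrow _ _)

theorem of_freeGen (t : CrossedModule.FreeGen (Basis.x (P := P)) e) :
    IsGenerator e t.fst.rel (Arrow.val t.snd) where
  cod := Arrow.cod t.snd
  inv_mul_mul := by
    rw [← Arrow.dom_mul t.snd, ← mul_assoc, (natLE_iff_inv_mul_mul _ _).1 t.fst.le]

theorem of_ψ_eq {p : P.T} (h : P.ψ (p * (P.ρτ s.1.1 * g)) = P.ψ e.val) (hg : g * e.val = g) :
    IsGenerator e s g := by
  have hcod : (P.ρτ s.1.1 * g)⁻¹ * (P.ρτ s.1.1 * g) = e.val :=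
    inv_mul_self_of_right_factor (P.ψ_ker e.idem h).2 (by rw [mul_assoc, hg])
  exact ⟨inv_mul_self_of_right_factor hcod hg, inv_mul_mul_of_right_factor hcod hg⟩

theorem act_bd_freeCMOf {d : P.T} (H' : IsGenerator e s' g)
    (H : IsGenerator e s (d * (P.ρτ s'.1.1 * g))) (K : IsGenerator e s (d * (P.ρτ s'.1.2 * g))) :
    P.freeCM.act (P.freeCM.bd e (freeCMOf H'.gen)) (freeCMOf H.gen) = freeCMOf K.gen := by
  refine (CrossedModule.act_freeOf ω _ _).trans (congrArg freeCMOf (freeGen_ext rfl ?_))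
  have hψ : P.ψ (P.ρτ s'.1.1 * g) = P.ψ (P.ρτ s'.1.2 * g) := by rw [map_mul, P.ψ_rel, map_mul]
  calc d * (P.ρτ s'.1.1 * g) * Arrow.val (P.freeCM.bd e (freeCMOf H'.gen))
      = d * (P.ρτ s'.1.1 * g) * ((P.ρτ s'.1.1 * g)⁻¹ * (P.ρτ s'.1.2 * g)) := by
        rw [bd_freeCMOf_val]
        rfl
    _ = d * (P.ρτ s'.1.1 * g * (P.ρτ s'.1.1 * g)⁻¹ * (P.ρτ s'.1.2 * g)) := by
        simp only [mul_assoc]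
    _ = d * (P.ρτ s'.1.2 * g) := by rw [P.ψ_idempotentSeparating.mul_inv_mul_eq_right hψ]

end IsGenerator

theorem ψ_edge_mul_idem {p q : P.T} {s : P.rels} (h : P.ψ (p * P.ρτ s.1.1 * q) = P.ψ e.val) :
    p * (P.ρτ s.1.1 * (q * e.val)) = p * P.ρτ s.1.1 * q := by
  rw [← mul_idem_of_ψ_eq h]
  simp only [mul_assoc]

theorem isGenerator_of_edge {p q : P.T} {s : P.rels}
    (h : P.ψ (p * P.ρτ s.1.1 * q) = P.ψ e.val) : IsGenerator e s (q * e.val) :=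
  .of_ψ_eq (p := p) (by rw [ψ_edge_mul_idem h, h]) (by rw [mul_assoc, e.idem])

open Classical in
/-- The element of `C_e` given by the edges `(p, l, r, q)` over the fibre of `ψ` at `e ψ`; it does
not depend on `p`. Off this fibre, where `q e` need not be a generator, it is `1` by convention. -/
noncomputable def edgeVal (e : Idem P.T) (s : P.rels) (q : P.T) : P.freeCM.C e :=
  if H : IsGenerator e s (q * e.val) then freeCMOf H.gen else 1

theorem edgeVal_eq {s : P.rels} {q : P.T} (H : IsGenerator e s (q * e.val)) :
    edgeVal e s q = freeCMOf H.gen := dif_pos H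

theorem edgeVal_freeGen (t : CrossedModule.FreeGen (Basis.x (P := P)) e) :
    edgeVal e t.fst.rel (Arrow.val t.snd) = freeCMOf t := by
  have hval := Arrow.mul_cod t.snd
  rw [edgeVal_eq (hval.symm ▸ IsGenerator.of_freeGen t)]
  exact congrArg freeCMOf (freeGen_ext rfl hval)

theorem edgeVal_interchange {s s' : P.rels} {p q q' : P.T}
    (h : P.ψ (p * P.ρτ s.1.1 * (q * P.ρτ s'.1.1 * q')) = P.ψ e.val) :
    edgeVal e s (q * P.ρτ s'.1.1 * q') * edgeVal e s' q' =
      edgeVal e s' q' * edgeVal e s (q * P.ρτ s'.1.2 * q') := by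
  have hassoc : ∀ u : P.T, q * u * q' * e.val = q * (u * (q' * e.val)) := fun u => by
    simp only [mul_assoc]
  have H := isGenerator_of_edge h
  have H' : IsGenerator e s' (q' * e.val) :=
    isGenerator_of_edge (p := p * P.ρτ s.1.1 * q) (by rw [← h]; simp only [mul_assoc])
  have K : IsGenerator e s (q * P.ρτ s'.1.2 * q' * e.val) :=
    isGenerator_of_edge (p := p) (by rw [← h]; simp only [map_mul, P.ψ_rel s'])
  rw [edgeVal_eq H, edgeVal_eq H', edgeVal_eq K]
  simp only [hassoc] at H K ⊢
  rw [← H'.act_bd_freeCMOf H K, P.freeCM.mul_act_bd]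

/-- The element of `C_e` given by an oriented edge. -/
noncomputable def sedgeVal (e : Idem P.T) (s : P.SEdge) : P.freeCM.C e :=
  bif s.fwd then edgeVal e s.edge.rel s.edge.q else (edgeVal e s.edge.rel s.edge.q)⁻¹

theorem sedgeVal_inv (e : Idem P.T) (s : P.SEdge) : sedgeVal e s.inv = (sedgeVal e s)⁻¹ := by
  obtain ⟨s, _ | _⟩ := s
  · exact (_root_.inv_inv _).symm
  · rfl

/-- The element of `C_e` given by a sequence of oriented edges. -/
noncomputable def pathVal (e : Idem P.T) (k : List P.SEdge) : P.freeCM.C e :=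
  (k.map (sedgeVal e)).prod

theorem pathVal_append (e : Idem P.T) (k j : List P.SEdge) :
    pathVal e (k ++ j) = pathVal e k * pathVal e j := by
  rw [pathVal, List.map_append, List.prod_append, pathVal, pathVal]

theorem pathVal_reverse (e : Idem P.T) (k : List P.SEdge) :
    pathVal e (k.map SEdge.inv).reverse = (pathVal e k)⁻¹ := by
  simp only [pathVal, List.prod_inv_reverse, List.map_reverse, List.map_map, Function.comp_def,
    sedgeVal_inv]

theorem pathVal_lw (e : Idem P.T) (x : P.T) (k : List P.SEdge) :
    pathVal e (k.map (SEdge.lw x)) = pathVal e k := by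
  rw [pathVal, List.map_map]
  rfl

theorem pathVal_single (e : Idem P.T) (s : P.Edge) :
    pathVal e (EdgePath.single s).edges = edgeVal e s.rel s.q :=
  List.prod_singleton

theorem pathVal_eq_of_hty {a b : P.T} {k j : List P.SEdge} (h : Hty a b k j)
    (ha : P.ψ a = P.ψ e.val) : pathVal e k = pathVal e j := by
  induction h with
  | refl => rfl
  | symm _ ih => exact (ih ha).symm
  | trans _ _ ih₁ ih₂ => exact (ih₁ ha).trans (ih₂ ha)
  | append h₁ _ ih₁ ih₂ =>
    rw [pathVal_append, pathVal_append, ih₁ ha, ih₂ (by rw [← h₁.isPath.1.ψ_eq, ha])]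
  | cancel s => simp [pathVal, sedgeVal_inv]
  | cell p q p' q' s s' =>
    have hcell := edgeVal_interchange (s := s) (s' := s') (p := p) (q := q * p') (q' := q') (by
      rw [← ha]; simp only [mul_assoc])
    simpa [pathVal, sedgeVal] using hcell

theorem toStar_edgeVal {s : P.Edge} (h : P.ψ (EdgePath.single s).d = P.ψ e.val) :
    P.toStar.map e (edgeVal e s.rel s.q) = StarBow.ofPath e (EdgePath.single s) h := by
  obtain ⟨p, s, q⟩ := s
  change P.ψ (p * P.ρτ s.1.1 * q) = P.ψ e.val at h
  have hp : (p * P.ρτ s.1.1 * q)⁻¹ * p = (P.ρτ s.1.1 * (q * e.val))⁻¹ := by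
    rw [← ψ_edge_mul_idem h]
    refine inv_mul_of_right_factor (e := e.val) ?_ (by simp only [mul_assoc, e.idem])
    rw [ψ_edge_mul_idem h, (P.ψ_ker e.idem h).2]
  refine Subtype.ext ?_
  rw [edgeVal_eq (isGenerator_of_edge h), toStar_freeCMOf]
  change _ = Pi1.mk (((EdgePath.single ⟨p, s, q⟩).rw e.val).lw (p * P.ρτ s.1.1 * q)⁻¹)
  rw [EdgePath.rw_single, EdgePath.lw_single, hp]
  rfl

theorem toStar_pathVal (α : P.EdgePath) (h : P.ψ α.d = P.ψ e.val) :
    P.toStar.map e (pathVal e α.edges) = StarBow.ofPath e α h := by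
  induction α using EdgePath.induction with
  | const x => exact (map_one (P.toStar.map e)).trans (StarBow.ofPath_const h).symm
  | single s => rw [pathVal_single, toStar_edgeVal h]
  | symm α ih =>
    rw [StarBow.ofPath_symm, ← ih]
    exact (congrArg _ (pathVal_reverse e α.edges)).trans (map_inv (P.toStar.map e) _)
  | comp α β hαβ ihα ihβ =>
    have hmap : P.toStar.map e (pathVal e (EdgePath.comp α β hαβ).edges) =
        P.toStar.map e (pathVal e α.edges) * P.toStar.map e (pathVal e β.edges) :=
      (congrArg _ (pathVal_append e α.edges β.edges)).trans (map_mul (P.toStar.map e) _ _)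
    exact hmap.trans ((congrArg₂ (· * ·) (ihα h) (ihβ _)).trans (StarBow.ofPath_comp hαβ h).symm)

/-! #### The inverse isomorphism -/

/-- The element of `C_e` given by the paths in a class of `star_e^⋈`. -/
noncomputable def starVal (α : StarBow e) : P.freeCM.C e :=
  pathVal e α.exists_adapted.choose.edges

theorem starVal_eq {α : StarBow e} {a : P.EdgePath} (hd : a.d = e.val) (ha : Pi1.mk a = α.1) :
    starVal α = pathVal e a.edges := by
  have hhty : a ≈ α.exists_adapted.choose :=
    Quotient.exact (ha.trans α.exists_adapted.choose_spec.2.symm)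
  exact (pathVal_eq_of_hty hhty.2.2 (congrArg _ hd)).symm

theorem starVal_mul (α β : StarBow e) : starVal (α * β) = starVal α * starVal β := by
  obtain ⟨a, ha, ha'⟩ := α.exists_adapted
  obtain ⟨b, hb, hb'⟩ := β.exists_adapted
  have hab : Pi1.mk (EdgePath.star a b) = (α * β).1 := congrArg₂ Pi1.star ha' hb'
  calc starVal (α * β) = pathVal e ((a.rw b.d).edges ++ (b.lw a.r).edges) :=
        starVal_eq (ha.star hb).d_eq hab
    _ = pathVal e a.edges * pathVal e b.edges := by
        rw [pathVal_append, hb.d_eq, ha.rw_eq, EdgePath.lw, pathVal_lw]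
    _ = starVal α * starVal β := by rw [starVal_eq ha.d_eq ha', starVal_eq hb.d_eq hb']

theorem starVal_toStar (c : P.freeCM.C e) : starVal (P.toStar.map e c : StarBow e) = c := by
  have hcomp : (MonoidHom.mk' starVal starVal_mul).comp (P.toStar.map e) =
      MonoidHom.id (P.freeCM.C e) := by
    refine CrossedModule.free_monoidHom_ext fun t => ?_
    have hd : (P.ρτ t.fst.rel.1.1 * Arrow.val t.snd)⁻¹ * P.ρτ t.fst.rel.1.1 * Arrow.val t.snd =
        e.val := by
      have H := IsGenerator.of_freeGen t
      rw [mul_inv', mul_assoc _⁻¹, mul_assoc, H.inv_mul_mul, H.cod]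
    exact (starVal_eq hd (toStar_freeCMOf t).symm).trans
      ((pathVal_single e _).trans (edgeVal_freeGen t))
  exact DFunLike.congr_fun hcomp c

theorem toStar_starVal (α : StarBow e) : P.toStar.map e (starVal α) = α := by
  obtain ⟨a, ha, ha'⟩ := α.exists_adapted
  rw [starVal_eq ha.d_eq ha', toStar_pathVal a (congrArg _ ha.d_eq)]
  exact Subtype.ext ((congrArg Pi1.mk ha.normalForm_eq).trans ha')

variable (P) in
/-- The isomorphism from the free crossed module to `S^⋈` that extends the basis edges. -/
noncomputable def starIso : CrossedModule.Iso P.freeCM P.starCM where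
  map e := MulEquiv.mk' ⟨P.toStar.map e, starVal, starVal_toStar, toStar_starVal⟩
    (map_mul (P.toStar.map e))
  bd_map := P.toStar.bd_map
  act_map := P.toStar.act_map

end InvPresentation

end Presentation

/-- The crossed module `P.freeCM` is free on `ω`, and it is isomorphic to `S^⋈ → 𝒯 ⇉ E(𝒯)`, by an
isomorphism that sends the basis element `(l, r, x)` to the class of the edge `(x h⁻¹, l, r, x)`
with `h = l ρ τ`. -/
theorem mainTheorem2 {X : Type u} {M : Type v} [InverseMonoid M] (P : InvPresentation X M) :
    CrossedModule.IsFreeOn.{u, u, u, u, w} P.freeCM InvPresentation.Basis.x InvPresentation.ω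
      InvPresentation.freeCMBasis ∧
    ∃ φ : CrossedModule.Iso P.freeCM P.starCM, ∀ s : P.Basis,
      (φ.map s.x (InvPresentation.freeCMBasis s) : InvPresentation.StarBow s.x).1 =
        InvPresentation.basisEdge s :=
  ⟨CrossedModule.free_isFreeOn _ _, P.starIso, fun s =>
    congrArg Subtype.val (InvPresentation.toStar_freeCMBasis s)⟩
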